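/- **Setting.** In round $t=1,\dots,T$ of a $d$-dimensional stochastic linear bandit, the learner is given a finite nonempty action set $\mathcal A_t$ with features $x_{t,a}\in\mathbb R^d$ (which may change with $t$ and depend on the past), chooses $a_t\in\mathcal A_t$, and receives $r_t(a_t)=\langle x_{t,a_t},\theta^*\rangle+\varepsilon_t$. Here $\|\theta^*\|\le W$, $\|x_{t,a}\|\le B$, and $\varepsilon_t$ is a martingale difference sequence that is conditionally $\sigma$-subgaussian: given everything up to and including the choice of $a_t$, $\mathbb E[e^{s\varepsilon_t}\mid\cdot]\le e^{\sigma^2s^2/2}$ for all $s\in\mathbb R$. Let $A$ bound all $|\mathcal A_t|$. The regret is $R(T)=\sum_{t=1}^T\bigl(\max_{a\in\mathcal A_t}\langle x_{t,a},\theta^*\rangle-\langle x_{t,a_t},\theta^*\rangle\bigr)$. **Algorithm (ACB with re-randomized history; parameters $M,\beta,\lambda$).** Set warm-start features $x_{-i+1}=\sqrt\lambda\,e_i$ for $i=1,\dots,d$, and write $x_\tau=x_{\tau,a_\tau}$ for $\tau\ge1$. In round $t$: 1. After $\mathcal A_t$ and its features are revealed, compute $\hat\theta_t=\arg\min_\theta\sum_{\tau=1}^{t-1}(\langle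 x_\tau,\theta\rangle-r_\tau(a_\tau))^2+\lambda\|\theta\|^2$. 2. Draw fresh targets $y_\tau^{(j)}\sim\mathcal N(0,1)$ for all $1\le j\le M$ and $-d+1\le\tau\le t-1$, i.i.d. and independent of everything before. 3. Compute $w_t^{(j)}=\arg\min_w\sum_{\tau=-d+1}^{t-1}(\langle x_\tau,w\rangle-y_\tau^{(j)})^2$ and $\mathrm{bonus}_t(a)=\beta\max_{j\le M}|\langle x_{t,a},w_t^{(j)}\rangle|$. 4. Play $a_t\in\arg\max_{a\in\mathcal A_t}\langle x_{t,a},\hat\theta_t\rangle+\mathrm{bonus}_t(a)$, breaking ties arbitrarily. **Proposition.** There is an absolute constant $k\in\mathbb N$ such that for all $B,W,\sigma\ge0$ and $0<c\le C$ there is a constant $K=K(B,W,\sigma,c,C)$ with the following property. For all $d\ge 0$, $T\ge1$ and $\delta\in(0,1)$ there are $\lambda,\beta>0$ (depending only on $B,W,\sigma,c,C,d,T,\delta$) such that, for every ensemble size $M$ with $c\log(T/\delta)\le M\le C(1+\log(T/\delta))$ and for every linear bandit as above, the algorithm satisfies, with probability at least $1-\delta$, $$R(T)\le K\,d\,\sqrt{T\log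 A}\;\bigl(1+\log(T/\delta)\bigr)^k .$$ In particular, if $A\le P\,d^{\,p}$ for some real $P$ and $p\in\mathbb N$, then with probability at least $1-\delta$ $$R(T)\le K\,d\,\sqrt{T\,(\log P+p\log d)}\;\bigl(1+\log(T/\delta)\bigr)^k ,$$ which is the LinUCB rate $\tilde O(d\sqrt T)$ up to logarithmic factors. -/

import Mathlib

open MeasureTheory ProbabilityTheory

/-- The trajectory of a learner in a `d`-dimensional linear bandit problem with action labels in `𝒜`,
as random quantities on `Ω`.  Rounds are numbered `0, 1, 2, …`. -/
structure BanditTrajectory (Ω 𝒜 : Type*) (d : ℕ) where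
  /-- the finite set of actions available in round `t` -/
  actions : ℕ → Ω → Finset 𝒜
  /-- the feature vector `x_{t,a}` -/
  feature : ℕ → Ω → 𝒜 → EuclideanSpace ℝ (Fin d)
  /-- the action `a_t` chosen by the learner -/
  action : ℕ → Ω → 𝒜
  /-- the reward noise `ε_t` -/
  noise : ℕ → Ω → ℝ

namespace BanditTrajectory

variable {Ω 𝒜 : Type*} {d : ℕ}

/-- The feature vector `x_{t,a_t}` of the chosen action. -/
def chosen (h : BanditTrajectory Ω 𝒜 d) (t : ℕ) (ω : Ω) : EuclideanSpace ℝ (Fin d) :=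
  h.feature t ω (h.action t ω)

/-- The observed reward `r_t(a_t) = ⟨x_{t,a_t}, θ⟩ + ε_t`. -/
noncomputable def reward (h : BanditTrajectory Ω 𝒜 d) (θ : EuclideanSpace ℝ (Fin d))
    (t : ℕ) (ω : Ω) : ℝ :=
  inner ℝ (h.chosen t ω) θ + h.noise t ω

/-- The regret after `T` rounds: the sum over the rounds of
`max_{a ∈ 𝒜_t} ⟨x_{t,a}, θ⟩ - ⟨x_{t,a_t}, θ⟩`. -/
noncomputable def regret (h : BanditTrajectory Ω 𝒜 d) (θ : EuclideanSpace ℝ (Fin d))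
    (T : ℕ) (ω : Ω) : ℝ :=
  ∑ t ∈ Finset.range T,
    ((⨆ a : {a // a ∈ h.actions t ω}, inner ℝ (h.feature t ω a) θ) - inner ℝ (h.chosen t ω) θ)

/-- The objective of `L²`-regularized least squares at round `t`,
`∑_{τ<t} (⟨x_{τ,a_τ}, v⟩ - r_τ(a_τ))² + λ ‖v‖²`. -/
noncomputable def ridgeLoss (h : BanditTrajectory Ω 𝒜 d) (θ : EuclideanSpace ℝ (Fin d))
    (lam : ℝ) (t : ℕ) (ω : Ω) (v : EuclideanSpace ℝ (Fin d)) : ℝ :=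
  ∑ τ ∈ Finset.range t, (inner ℝ (h.chosen τ ω) v - h.reward θ τ ω) ^ 2 + lam * ‖v‖ ^ 2

/-- The least-squares objective of one noise regressor at round `t`.  The regression data are the `d`
warm-start features `√λ e_i`, with targets `y (inl i)`, and the features `x_{τ,a_τ}` of the past
rounds `τ < t`, with targets `y (inr τ)`. -/
noncomputable def noiseLoss (h : BanditTrajectory Ω 𝒜 d) (lam : ℝ) (t : ℕ) (ω : Ω)
    (y : Fin d ⊕ Fin t → ℝ) (w : EuclideanSpace ℝ (Fin d)) : ℝ :=
  ∑ i : Fin d,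
      (inner ℝ (Real.sqrt lam • EuclideanSpace.single i (1 : ℝ)) w - y (Sum.inl i)) ^ 2
    + ∑ τ : Fin t, (inner ℝ (h.chosen τ ω) w - y (Sum.inr τ)) ^ 2

end BanditTrajectory

/-- `X` is conditionally `σ`-subgaussian given the `σ`-algebra `𝒢`:
`E[exp(sX) | 𝒢] ≤ exp(σ² s² / 2)` almost surely, for every real `s`. -/
def IsCondSubgaussian {Ω : Type*} [MeasurableSpace Ω] (μ : Measure Ω) (𝒢 : MeasurableSpace Ω)
    (X : Ω → ℝ) (σ : ℝ) : Prop :=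
  ∀ s : ℝ, Integrable (fun ω => Real.exp (s * X ω)) μ ∧
    (μ[fun ω => Real.exp (s * X ω) | 𝒢]) ≤ᵐ[μ] fun _ => Real.exp (σ ^ 2 * s ^ 2 / 2)

/-- The environment of a stochastic linear bandit over the rounds `t < T`, with possibly changing and
possibly history-dependent action sets.  `ℱ t` is the information available when the action set and
the features of round `t` are revealed, before the learner randomizes; `𝒢 t` is the information
available once the learner has chosen its action of round `t`, before the reward is revealed. -/
structure IsLinearBandit {Ω 𝒜 : Type*} [mΩ : MeasurableSpace Ω] (μ : Measure Ω) {d : ℕ}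
    (h : BanditTrajectory Ω 𝒜 d) (ℱ 𝒢 : ℕ → MeasurableSpace Ω)
    (T A : ℕ) (B σ : ℝ) : Prop where
  le_ambient : ∀ t, ℱ t ≤ mΩ ∧ 𝒢 t ≤ mΩ
  interleaved : ∀ t, ℱ t ≤ 𝒢 t ∧ 𝒢 t ≤ ℱ (t + 1)
  /-- Only countably many action labels ever occur; this is automatic if the action sets are not
  random. -/
  countable_labels : (⋃ t, ⋃ ω, (h.actions t ω : Set 𝒜)).Countable
  actions_nonempty : ∀ t < T, ∀ ω, (h.actions t ω).Nonempty
  actions_card_le : ∀ t < T, ∀ ω, (h.actions t ω).card ≤ A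
  actions_measurable : ∀ t < T, ∀ a, MeasurableSet[ℱ t] {ω | a ∈ h.actions t ω}
  feature_measurable : ∀ t < T, ∀ a, Measurable[ℱ t] fun ω => h.feature t ω a
  feature_norm_le : ∀ t < T, ∀ ω, ∀ a ∈ h.actions t ω, ‖h.feature t ω a‖ ≤ B
  action_measurable : ∀ t < T, ∀ a, MeasurableSet[𝒢 t] {ω | h.action t ω = a}
  noise_measurable : ∀ t < T, Measurable[ℱ (t + 1)] (h.noise t)
  noise_martingale_difference : ∀ t < T,
    Integrable (h.noise t) μ ∧ μ[h.noise t | 𝒢 t] =ᵐ[μ] 0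
  noise_subgaussian : ∀ t < T, IsCondSubgaussian μ (𝒢 t) (h.noise t) σ

/-- The internal quantities of the algorithm with an ensemble of `M` noise regressors. -/
structure ACBState (Ω : Type*) (d M : ℕ) where
  /-- the regression targets `y_τ^{(j)}` used in round `t`, for the `d` warm-start features and for
  the rounds `τ < t` -/
  target : (t : ℕ) → Ω → Fin M → (Fin d ⊕ Fin t) → ℝ
  /-- the reward estimator `θ̂_t` -/
  thetaHat : ℕ → Ω → EuclideanSpace ℝ (Fin d)
  /-- the noise regressors `w_t^{(j)}` -/
  weight : ℕ → Ω → Fin M → EuclideanSpace ℝ (Fin d)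

/-- The bonus `β max_j |⟨x, w_t^{(j)}⟩|` of an action with feature vector `x`. -/
noncomputable def ACBState.bonus {Ω : Type*} {d M : ℕ} (s : ACBState Ω d M) (β : ℝ) (t : ℕ) (ω : Ω)
    (x : EuclideanSpace ℝ (Fin d)) : ℝ :=
  β * ⨆ j : Fin M, |inner ℝ x (s.weight t ω j)|

/-- The trajectory `h` is produced by ACB with re-randomized history and parameters `M`, `β`, `λ`,
in the rounds `t < T`.  Ties in the choice of the action are broken arbitrarily. -/
structure IsRerandomizedACB {Ω 𝒜 : Type*} [MeasurableSpace Ω] (μ : Measure Ω) {d M : ℕ}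
    (h : BanditTrajectory Ω 𝒜 d) (s : ACBState Ω d M) (ℱ 𝒢 : ℕ → MeasurableSpace Ω)
    (T : ℕ) (θ : EuclideanSpace ℝ (Fin d)) (lam β : ℝ) : Prop where
  /-- in every round all targets are sampled afresh, i.i.d. from `N(0, 1)` … -/
  target_law : ∀ t < T,
    HasLaw (s.target t) (Measure.pi fun _ => Measure.pi fun _ => gaussianReal 0 1) μ
  /-- … independently of everything that happened before -/
  target_indep : ∀ t < T, Indep (MeasurableSpace.comap (s.target t) inferInstance) (ℱ t) μ
  target_measurable : ∀ t < T, Measurable[𝒢 t] (s.target t)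
  thetaHat_argmin : ∀ t < T, ∀ ω, IsMinOn (h.ridgeLoss θ lam t ω) Set.univ (s.thetaHat t ω)
  weight_argmin : ∀ t < T, ∀ ω, ∀ j,
    IsMinOn (h.noiseLoss lam t ω (s.target t ω j)) Set.univ (s.weight t ω j)
  action_mem : ∀ t < T, ∀ ω, h.action t ω ∈ h.actions t ω
  action_argmax : ∀ t < T, ∀ ω,
    IsMaxOn (fun a => inner ℝ (h.feature t ω a) (s.thetaHat t ω) + s.bonus β t ω (h.feature t ω a))
      (h.actions t ω : Set 𝒜) (h.action t ω)

/-! Write V_t = λI + ∑_{τ<t} x_τ x_τᵀ and call √(xᵀ V_t⁻¹ x) the width of x; `sqWidth` is its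
square. The whole argument compares three quantities with widths.

Bonus. A noise regressor is linear in its targets, and the coefficients of its prediction at x have
squared norm xᵀ V_t⁻¹ x, the warm-start features supplying exactly the λI
(`inner_eq_predictionCoef_dotProduct`, `predictionCoef_dotProduct_self`). Given the past, the
prediction is a centred Gaussian whose standard deviation is the width. All M regressors fall below
u times the width with probability at most u^M. This is needed only at one optimal action, which is
determined before the targets are drawn, so M of order log(T/δ) suffices without a union bound over
actions (`measure_not_exists_optimistic_le`). In the other direction, a union bound over actions and
regressors bounds all predictions by D times the width, with D of order √log(AMT/δ)
(`measure_exists_weight_large_le`); this is the only source of √log A.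

Estimate. The error of the ridge predictor is at most α times the width, with α of order √d up to
logarithms. This is the self-normalized martingale bound, proved by the method of mixtures
(`measure_lt_sqWidth_le`, `abs_inner_sub_inner_le`).

Regret. With β = α/u the bonus dominates the estimation error at an optimal action, so by optimism a
round costs at most (α + βD) times the width of the played feature (`regret_term_le`). By
Cauchy–Schwarz and the elliptical potential bound (`sum_sqWidth_le`) the widths sum to order √(dT)
up to logarithms. The product is d √(T log A) times (1 + log(T/δ))³. -/

open Matrix in
/-- The regularized Gram matrix `λ I + ∑_{τ<t} x_τ x_τᵀ`. -/
noncomputable def gramMatrix {d : ℕ} (lam : ℝ) (x : ℕ → Fin d → ℝ) (t : ℕ) :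
    Matrix (Fin d) (Fin d) ℝ :=
  lam • (1 : Matrix (Fin d) (Fin d) ℝ) + ∑ τ ∈ Finset.range t, vecMulVec (x τ) (x τ)

open Matrix in
/-- The squared norm `yᵀ V⁻¹ y` of `y` in the geometry of the inverse Gram matrix. -/
noncomputable def sqWidth {d : ℕ} (lam : ℝ) (x : ℕ → Fin d → ℝ) (t : ℕ) (y : Fin d → ℝ) : ℝ :=
  y ⬝ᵥ ((gramMatrix lam x t)⁻¹ *ᵥ y)

/-! ### Gram matrices, widths and the elliptical potential -/

section Gram

open Matrix

variable {d : ℕ} {lam : ℝ} {x : ℕ → Fin d → ℝ} {t : ℕ}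

theorem dotProduct_gramMatrix_mulVec (u z : Fin d → ℝ) :
    u ⬝ᵥ (gramMatrix lam x t *ᵥ z)
      = lam * (u ⬝ᵥ z) + ∑ τ ∈ Finset.range t, (x τ ⬝ᵥ u) * (x τ ⬝ᵥ z) := by
  simp only [gramMatrix, add_mulVec, smul_mulVec, one_mulVec, dotProduct_add, dotProduct_smul,
    smul_eq_mul, sum_mulVec, dotProduct_sum, add_right_inj]
  refine Finset.sum_congr rfl fun τ _ => ?_
  rw [vecMulVec_mulVec, op_smul_eq_smul, dotProduct_smul, smul_eq_mul, dotProduct_comm u, mul_comm]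

theorem gramMatrix_isHermitian : (gramMatrix lam x t).IsHermitian := by
  ext i j
  simp [gramMatrix, Matrix.add_apply, Matrix.sum_apply, vecMulVec_apply, Matrix.one_apply,
    eq_comm, mul_comm]

theorem gramMatrix_posDef (hlam : 0 < lam) : (gramMatrix lam x t).PosDef := by
  refine PosDef.of_dotProduct_mulVec_pos gramMatrix_isHermitian fun z hz => ?_
  rw [star_trivial, dotProduct_gramMatrix_mulVec]
  have h1 : 0 < z ⬝ᵥ z := by
    have := dotProduct_star_self_pos_iff.mpr hz
    simpa using this
  have h2 : 0 ≤ ∑ τ ∈ Finset.range t, (x τ ⬝ᵥ z) * (x τ ⬝ᵥ z) :=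
    Finset.sum_nonneg fun _ _ => mul_self_nonneg _
  positivity

theorem gramMatrix_mulVec_inv_mulVec (hlam : 0 < lam) (y : Fin d → ℝ) :
    gramMatrix lam x t *ᵥ ((gramMatrix lam x t)⁻¹ *ᵥ y) = y := by
  rw [mulVec_mulVec, mul_nonsing_inv _ (gramMatrix_posDef hlam).det_pos.ne'.isUnit, one_mulVec]

/-- Substitute y = Vz and expand V. The two summands are the contributions of the warm-start
features and of the past rounds, which is how least-squares predictions are recognised later. -/
theorem dotProduct_eq_of_gramMatrix (hlam : 0 < lam) (y w : Fin d → ℝ) :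
    y ⬝ᵥ w = lam * (((gramMatrix lam x t)⁻¹ *ᵥ y) ⬝ᵥ w)
      + ∑ τ ∈ Finset.range t, (x τ ⬝ᵥ ((gramMatrix lam x t)⁻¹ *ᵥ y)) * (x τ ⬝ᵥ w) := by
  set z := (gramMatrix lam x t)⁻¹ *ᵥ y with hz
  have h : gramMatrix lam x t *ᵥ z = y := gramMatrix_mulVec_inv_mulVec hlam y
  calc y ⬝ᵥ w = w ⬝ᵥ (gramMatrix lam x t *ᵥ z) := by rw [h, dotProduct_comm]
    _ = _ := by
      rw [dotProduct_gramMatrix_mulVec, dotProduct_comm w z]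
      simp only [mul_comm]

theorem sqWidth_eq (hlam : 0 < lam) (y : Fin d → ℝ) :
    sqWidth lam x t y
      = lam * (((gramMatrix lam x t)⁻¹ *ᵥ y) ⬝ᵥ ((gramMatrix lam x t)⁻¹ *ᵥ y))
        + ∑ τ ∈ Finset.range t, (x τ ⬝ᵥ ((gramMatrix lam x t)⁻¹ *ᵥ y)) ^ 2 := by
  rw [sqWidth, dotProduct_eq_of_gramMatrix (x := x) (t := t) hlam]
  simp only [sq]

theorem dotProduct_self_nonneg' {ι : Type*} [Fintype ι] (z : ι → ℝ) : 0 ≤ z ⬝ᵥ z :=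
  Finset.sum_nonneg fun _ _ => mul_self_nonneg _

theorem dotProduct_sq_le {ι : Type*} [Fintype ι] (y z : ι → ℝ) :
    (y ⬝ᵥ z) ^ 2 ≤ (y ⬝ᵥ y) * (z ⬝ᵥ z) := by
  simpa only [dotProduct, sq] using Finset.sum_mul_sq_le_sq_mul_sq Finset.univ y z

theorem sqWidth_nonneg (hlam : 0 < lam) (y : Fin d → ℝ) : 0 ≤ sqWidth lam x t y := by
  rw [sqWidth_eq hlam]
  have := dotProduct_self_nonneg' ((gramMatrix lam x t)⁻¹ *ᵥ y)
  have h2 : 0 ≤ ∑ τ ∈ Finset.range t, (x τ ⬝ᵥ ((gramMatrix lam x t)⁻¹ *ᵥ y)) ^ 2 :=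
    Finset.sum_nonneg fun _ _ => sq_nonneg _
  positivity

theorem mul_dotProduct_inv_mulVec_le (hlam : 0 < lam) (y : Fin d → ℝ) :
    lam * (((gramMatrix lam x t)⁻¹ *ᵥ y) ⬝ᵥ ((gramMatrix lam x t)⁻¹ *ᵥ y))
      ≤ sqWidth lam x t y := by
  rw [sqWidth_eq hlam]
  exact le_add_of_nonneg_right (Finset.sum_nonneg fun _ _ => sq_nonneg _)

/-- With z = V⁻¹y and q = y ⬝ᵥ z, Cauchy–Schwarz gives λq² ≤ |y|² · λ|z|² ≤ |y|² q, and a positive q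
cancels. -/
theorem sqWidth_le (hlam : 0 < lam) (y : Fin d → ℝ) :
    sqWidth lam x t y ≤ (y ⬝ᵥ y) / lam := by
  have h1 := mul_dotProduct_inv_mulVec_le (x := x) (t := t) hlam y
  have h2 : sqWidth lam x t y ^ 2 ≤ _ := dotProduct_sq_le y ((gramMatrix lam x t)⁻¹ *ᵥ y)
  have h0 := sqWidth_nonneg (x := x) (t := t) hlam y
  have hy := dotProduct_self_nonneg' y
  rw [le_div_iff₀ hlam]
  rcases h0.eq_or_lt with h | h
  · rw [← h]; simpa using hy
  · nlinarith

/-- Matrix determinant lemma for the rank-one update by x_t x_tᵀ. -/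
theorem det_gramMatrix_succ (hlam : 0 < lam) :
    (gramMatrix lam x (t + 1)).det
      = (gramMatrix lam x t).det * (1 + sqWidth lam x t (x t)) := by
  have h : gramMatrix lam x (t + 1)
      = gramMatrix lam x t + replicateCol Unit (x t) * replicateRow Unit (x t) := by
    rw [← vecMulVec_eq, gramMatrix, gramMatrix, Finset.sum_range_succ, add_assoc]
  rw [h, det_add_replicateCol_mul_replicateRow (gramMatrix_posDef hlam).det_pos.ne'.isUnit,
    Matrix.mul_assoc, ← replicateCol_mulVec, det_unique (n := Unit)]
  congr 1

theorem det_gramMatrix_eq_prod (hlam : 0 < lam) :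
    (gramMatrix lam x t).det
      = lam ^ d * ∏ τ ∈ Finset.range t, (1 + sqWidth lam x τ (x τ)) := by
  induction t with
  | zero => simp [gramMatrix]
  | succ t ih => rw [det_gramMatrix_succ hlam, ih, Finset.prod_range_succ, mul_assoc]

theorem dotProduct_gramMatrix_mulVec_self_le {b : ℝ} (hx : ∀ τ < t, x τ ⬝ᵥ x τ ≤ b)
    (z : Fin d → ℝ) :
    z ⬝ᵥ (gramMatrix lam x t *ᵥ z) ≤ (lam + t * b) * (z ⬝ᵥ z) := by
  rw [dotProduct_gramMatrix_mulVec, add_mul]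
  gcongr
  calc ∑ τ ∈ Finset.range t, (x τ ⬝ᵥ z) * (x τ ⬝ᵥ z)
      ≤ ∑ τ ∈ Finset.range t, b * (z ⬝ᵥ z) := by
        refine Finset.sum_le_sum fun τ hτ => ?_
        rw [← sq]
        exact (dotProduct_sq_le _ _).trans
          (mul_le_mul_of_nonneg_right (hx τ (Finset.mem_range.mp hτ)) (dotProduct_self_nonneg' z))
    _ = t * b * (z ⬝ᵥ z) := by simp [mul_assoc]

/-- The determinant is the product of d eigenvalues, each being the quadratic form at a unit
eigenvector. -/
theorem det_gramMatrix_le (hlam : 0 < lam) {b : ℝ} (hx : ∀ τ < t, x τ ⬝ᵥ x τ ≤ b) :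
    (gramMatrix lam x t).det ≤ (lam + t * b) ^ d := by
  have hA : (gramMatrix lam x t).IsHermitian := gramMatrix_isHermitian
  rw [hA.det_eq_prod_eigenvalues]
  have hcard : (lam + t * b) ^ d = ∏ _i : Fin d, (lam + t * b) := by simp
  rw [hcard]
  refine Finset.prod_le_prod (fun i _ => ?_) fun i _ => ?_
  · exact ((gramMatrix_posDef hlam).eigenvalues_pos i).le
  · have h1 := hA.mulVec_eigenvectorBasis i
    set e : Fin d → ℝ := ⇑(hA.eigenvectorBasis i) with he
    have h2 : e ⬝ᵥ e = 1 := by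
      have h3 : ‖hA.eigenvectorBasis i‖ ^ 2 = 1 := by simp
      rw [EuclideanSpace.real_norm_sq_eq] at h3
      simpa only [dotProduct, sq] using h3
    have h3 := dotProduct_gramMatrix_mulVec_self_le (lam := lam) hx e
    rw [h1, dotProduct_smul, h2] at h3
    simpa using h3

/-- Elliptical potential argument. The condition b ≤ λ keeps every squared width q in [0, 1], where
q ≤ 2 log(1 + q); the logarithms add up to log(det V_t / λ^d), which the eigenvalue bound controls.
-/
theorem sum_sqWidth_le (hlam : 0 < lam) {b : ℝ} (hb : b ≤ lam) (hx : ∀ τ < t, x τ ⬝ᵥ x τ ≤ b) :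
    ∑ τ ∈ Finset.range t, sqWidth lam x τ (x τ) ≤ 2 * d * Real.log (1 + t * b / lam) := by
  have hw0 : ∀ τ, 0 ≤ sqWidth lam x τ (x τ) := fun τ => sqWidth_nonneg hlam _
  have hstep : ∀ τ ∈ Finset.range t,
      sqWidth lam x τ (x τ) ≤ 2 * Real.log (1 + sqWidth lam x τ (x τ)) := by
    intro τ hτ
    have h1 : sqWidth lam x τ (x τ) ≤ 1 :=
      (sqWidth_le hlam _).trans
        ((div_le_one hlam).mpr ((hx τ (Finset.mem_range.mp hτ)).trans hb))
    have h2 := Real.one_sub_inv_le_log_of_pos (x := 1 + sqWidth lam x τ (x τ))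
      (by linarith [hw0 τ])
    have h3 : sqWidth lam x τ (x τ) ≤ 2 * (1 - (1 + sqWidth lam x τ (x τ))⁻¹) := by
      have h4 : (0 : ℝ) < 1 + sqWidth lam x τ (x τ) := by linarith [hw0 τ]
      have h5 : 1 - (1 + sqWidth lam x τ (x τ))⁻¹
          = sqWidth lam x τ (x τ) / (1 + sqWidth lam x τ (x τ)) := by
        field_simp; ring
      rw [h5, mul_div_assoc', le_div_iff₀ h4]
      nlinarith [hw0 τ]
    linarith
  refine (Finset.sum_le_sum hstep).trans ?_
  rw [← Finset.mul_sum, ← Real.log_prod (fun τ _ => by linarith [hw0 τ]), mul_assoc]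
  refine mul_le_mul_of_nonneg_left ?_ zero_le_two
  have hdet := det_gramMatrix_le hlam hx
  rw [det_gramMatrix_eq_prod hlam] at hdet
  rw [← Real.log_pow]
  refine Real.log_le_log (Finset.prod_pos fun τ _ => by linarith [hw0 τ]) ?_
  have h6 : 1 + t * b / lam = (lam + t * b) / lam := by field_simp
  rw [h6, div_pow, le_div_iff₀ (by positivity), mul_comm]
  exact hdet

end Gram

/-- The normal equations of a least-squares problem. -/
theorem sum_mul_residual_eq_zero_of_isMinOn {ι E : Type*} [NormedAddCommGroup E]
    [InnerProductSpace ℝ E] (s : Finset ι) (φ : ι → E) (y : ι → ℝ) {w : E}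
    (hw : IsMinOn (fun v => ∑ i ∈ s, (inner ℝ (φ i) v - y i) ^ 2) Set.univ w) (z : E) :
    ∑ i ∈ s, inner ℝ (φ i) z * (inner ℝ (φ i) w - y i) = 0 := by
  set a := ∑ i ∈ s, inner ℝ (φ i) z * (inner ℝ (φ i) w - y i) with ha
  set b := ∑ i ∈ s, (inner ℝ (φ i) z) ^ 2 with hb
  have hb0 : 0 ≤ b := Finset.sum_nonneg fun _ _ => sq_nonneg _
  have key : ∀ r : ℝ, 0 ≤ 2 * r * a + r ^ 2 * b := by
    intro r
    have h := isMinOn_iff.mp hw (w + r • z) (Set.mem_univ _)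
    have h2 : ∑ i ∈ s, (inner ℝ (φ i) (w + r • z) - y i) ^ 2
        = ∑ i ∈ s, (inner ℝ (φ i) w - y i) ^ 2 + (2 * r * a + r ^ 2 * b) := by
      rw [ha, hb, Finset.mul_sum, Finset.mul_sum, ← Finset.sum_add_distrib,
        ← Finset.sum_add_distrib]
      refine Finset.sum_congr rfl fun i _ => ?_
      rw [inner_add_right, real_inner_smul_right]
      ring
    simp only [h2] at h
    linarith
  by_contra hne
  have hb1 : 0 < b + 1 := by linarith
  -- The quadratic 2ra + r²b is negative at this r unless a = 0; b + 1 in place of b avoids dividing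
  -- by zero.
  have h := key (-a / (b + 1))
  have h3 : 2 * (-a / (b + 1)) * a + (-a / (b + 1)) ^ 2 * b
      = -(a ^ 2 * (b + 2)) / (b + 1) ^ 2 := by field_simp; ring
  rw [h3] at h
  have h4 : 0 < a ^ 2 * (b + 2) / (b + 1) ^ 2 := by positivity
  rw [neg_div] at h
  linarith

/-! ### Gaussian estimates for linear forms in the targets -/

section Gaussian

open Matrix

/-- The characteristic function factorises over coordinates, and the exponents add up to -t²|a|²/2.
-/
theorem map_dotProduct_pi_gaussianReal {ι : Type*} [Fintype ι] {a : ι → ℝ} (ha : a ⬝ᵥ a = 1) :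
    (Measure.pi fun _ : ι => gaussianReal 0 1).map (fun y => a ⬝ᵥ y) = gaussianReal 0 1 := by
  have hmeas : Measurable fun y : ι → ℝ => a ⬝ᵥ y := by unfold dotProduct; fun_prop
  have : IsProbabilityMeasure ((Measure.pi fun _ : ι => gaussianReal 0 1).map fun y => a ⬝ᵥ y) :=
    Measure.isProbabilityMeasure_map hmeas.aemeasurable
  refine Measure.ext_of_charFun ?_
  ext t
  rw [charFun_apply_real, integral_map hmeas.aemeasurable (by fun_prop)]
  have h1 : ∀ y : ι → ℝ, Complex.exp (t * (a ⬝ᵥ y : ℝ) * Complex.I)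
      = ∏ i, Complex.exp ((t * a i : ℝ) * y i * Complex.I) := by
    intro y
    rw [← Complex.exp_sum]
    congr 1
    simp only [dotProduct, Complex.ofReal_sum, Finset.mul_sum, Finset.sum_mul]
    refine Finset.sum_congr rfl fun i _ => ?_
    push_cast
    ring
  simp_rw [h1]
  rw [integral_fintype_prod_eq_prod
    (f := fun i (x : ℝ) => Complex.exp ((t * a i : ℝ) * x * Complex.I))]
  simp_rw [← charFun_apply_real, charFun_gaussianReal]
  rw [← Complex.exp_sum]
  congr 1
  have h2 : ((∑ i, a i * a i : ℝ) : ℂ) = 1 := by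
    rw [← Complex.ofReal_one, ← ha, dotProduct]
  push_cast at h2 ⊢
  simp only [mul_zero, zero_mul, zero_sub, one_mul]
  rw [Finset.sum_neg_distrib, ← Finset.sum_div]
  congr 2
  simp_rw [mul_pow]
  rw [← Finset.mul_sum]
  simp only [sq] at h2 ⊢
  rw [h2, mul_one]

/-- The density is at most 1/√(2π) ≤ 1/2, on an interval of length 2u. -/
theorem gaussianReal_abs_lt_le {u : ℝ} :
    gaussianReal 0 1 {g : ℝ | |g| < u} ≤ ENNReal.ofReal u := by
  have hs : {g : ℝ | |g| < u} = Set.Ioo (-u) u := by ext g; simp [abs_lt]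
  rw [gaussianReal_apply 0 one_ne_zero, hs]
  have hpdf : ∀ x, gaussianPDF 0 1 x ≤ ENNReal.ofReal (1 / 2) := by
    intro x
    rw [gaussianPDF]
    refine ENNReal.ofReal_le_ofReal ?_
    rw [gaussianPDFReal_def]
    have h2 : (2 : ℝ) ≤ √(2 * Real.pi * (1 : NNReal)) := by
      refine Real.le_sqrt_of_sq_le ?_
      have := Real.pi_gt_three
      simp
      linarith
    have h3 : Real.exp (-(x - 0) ^ 2 / (2 * (1 : NNReal))) ≤ 1 := by
      rw [Real.exp_le_one_iff]
      have : 0 ≤ (x - 0) ^ 2 / (2 * ((1 : NNReal) : ℝ)) := by positivity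
      rw [neg_div]
      linarith
    calc (√(2 * Real.pi * (1 : NNReal)))⁻¹ * Real.exp (-(x - 0) ^ 2 / (2 * (1 : NNReal)))
        ≤ (2 : ℝ)⁻¹ * 1 := by gcongr
      _ = 1 / 2 := by norm_num
  calc ∫⁻ x in Set.Ioo (-u) u, gaussianPDF 0 1 x
      ≤ ∫⁻ _ in Set.Ioo (-u) u, ENNReal.ofReal (1 / 2) := lintegral_mono hpdf
    _ = ENNReal.ofReal u := by
      rw [setLIntegral_const, Real.volume_Ioo, ← ENNReal.ofReal_mul (by norm_num)]
      congr 1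
      ring

theorem gaussianReal_lt_abs_le {D : ℝ} (hD : 0 ≤ D) :
    gaussianReal 0 1 {g : ℝ | D < |g|} ≤ ENNReal.ofReal (2 * Real.exp (-D ^ 2 / 2)) := by
  have hsub : HasSubgaussianMGF id 1 (gaussianReal 0 1) := by
    refine ⟨fun t => ?_, fun t => ?_⟩
    · simpa using integrable_exp_mul_gaussianReal t
    · rw [mgf_id_gaussianReal]; simp
  have h1 := hsub.measure_ge_le hD
  have h2 := hsub.neg.measure_ge_le hD
  have hsplit : {g : ℝ | D < |g|} ⊆ {g | D ≤ id g} ∪ {g | D ≤ (-id) g} := by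
    intro g hg
    rcases lt_abs.mp (Set.mem_ofPred_eq ▸ hg) with h | h
    · exact Or.inl h.le
    · exact Or.inr h.le
  refine (measure_mono hsplit).trans ((measure_union_le _ _).trans ?_)
  rw [two_mul, ENNReal.ofReal_add (Real.exp_pos _).le (Real.exp_pos _).le]
  simp only [NNReal.coe_one, mul_one] at h1 h2
  refine add_le_add ?_ ?_
  · rw [← ofReal_measureReal]; exact ENNReal.ofReal_le_ofReal h1
  · rw [← ofReal_measureReal]; exact ENNReal.ofReal_le_ofReal h2

theorem dotProduct_normalize {ι : Type*} [Fintype ι] {a : ι → ℝ} (ha : 0 < a ⬝ᵥ a) :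
    ((√(a ⬝ᵥ a))⁻¹ • a) ⬝ᵥ ((√(a ⬝ᵥ a))⁻¹ • a) = 1 := by
  rw [smul_dotProduct, dotProduct_smul, smul_eq_mul, smul_eq_mul, ← mul_assoc, ← mul_inv,
    Real.mul_self_sqrt ha.le, inv_mul_cancel₀ ha.ne']

/-- Normalise a to reduce to one standard Gaussian. The strict inequality makes the event empty when
a = 0, so no nondegeneracy is needed. -/
theorem pi_gaussianReal_abs_dotProduct_lt_le {ι : Type*} [Fintype ι] (a : ι → ℝ) {u : ℝ} :
    (Measure.pi fun _ : ι => gaussianReal 0 1) {y | |a ⬝ᵥ y| < u * √(a ⬝ᵥ a)}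
      ≤ ENNReal.ofReal u := by
  have h0 : 0 ≤ a ⬝ᵥ a := Finset.sum_nonneg fun _ _ => mul_self_nonneg _
  rcases h0.eq_or_lt with h | h
  · have : {y : ι → ℝ | |a ⬝ᵥ y| < u * √(a ⬝ᵥ a)} = ∅ := by
      ext y; simp [← h]
    simp [this]
  · have hpos : 0 < √(a ⬝ᵥ a) := Real.sqrt_pos.mpr h
    set b := (√(a ⬝ᵥ a))⁻¹ • a with hb
    have hset : {y : ι → ℝ | |a ⬝ᵥ y| < u * √(a ⬝ᵥ a)}
        = (fun y => b ⬝ᵥ y) ⁻¹' {g | |g| < u} := by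
      ext y
      simp only [Set.mem_ofPred_eq, Set.mem_preimage, hb, smul_dotProduct, smul_eq_mul, abs_mul,
        abs_inv, abs_of_pos hpos]
      rw [inv_mul_lt_iff₀ hpos, mul_comm]
    have hmeas : Measurable fun y : ι → ℝ => b ⬝ᵥ y := by unfold dotProduct; fun_prop
    rw [hset, ← Measure.map_apply hmeas (measurableSet_lt (by fun_prop) (by fun_prop)),
      map_dotProduct_pi_gaussianReal (dotProduct_normalize h)]
    exact gaussianReal_abs_lt_le

theorem pi_gaussianReal_lt_abs_dotProduct_le {ι : Type*} [Fintype ι] (a : ι → ℝ) {D : ℝ}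
    (hD : 0 ≤ D) :
    (Measure.pi fun _ : ι => gaussianReal 0 1) {y | D * √(a ⬝ᵥ a) < |a ⬝ᵥ y|}
      ≤ ENNReal.ofReal (2 * Real.exp (-D ^ 2 / 2)) := by
  have h0 : 0 ≤ a ⬝ᵥ a := Finset.sum_nonneg fun _ _ => mul_self_nonneg _
  rcases h0.eq_or_lt with h | h
  · have ha : a = 0 := dotProduct_self_eq_zero.mp h.symm
    simp [ha]
  · have hpos : 0 < √(a ⬝ᵥ a) := Real.sqrt_pos.mpr h
    set b := (√(a ⬝ᵥ a))⁻¹ • a with hb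
    have hset : {y : ι → ℝ | D * √(a ⬝ᵥ a) < |a ⬝ᵥ y|}
        = (fun y => b ⬝ᵥ y) ⁻¹' {g | D < |g|} := by
      ext y
      simp only [Set.mem_ofPred_eq, Set.mem_preimage, hb, smul_dotProduct, smul_eq_mul, abs_mul,
        abs_inv, abs_of_pos hpos]
      rw [lt_inv_mul_iff₀ hpos, mul_comm]
    have hmeas : Measurable fun y : ι → ℝ => b ⬝ᵥ y := by unfold dotProduct; fun_prop
    rw [hset, ← Measure.map_apply hmeas (measurableSet_lt (by fun_prop) (by fun_prop)),
      map_dotProduct_pi_gaussianReal (dotProduct_normalize h)]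
    exact gaussianReal_lt_abs_le hD

theorem pi_pi_gaussianReal_forall_lt_le {ι : Type*} [Fintype ι] (M : ℕ) (a : ι → ℝ) {u : ℝ} :
    (Measure.pi fun _ : Fin M => Measure.pi fun _ : ι => gaussianReal 0 1)
        {y | ∀ j, |a ⬝ᵥ y j| < u * √(a ⬝ᵥ a)} ≤ ENNReal.ofReal u ^ M := by
  have hset : {y : Fin M → ι → ℝ | ∀ j, |a ⬝ᵥ y j| < u * √(a ⬝ᵥ a)}
      = Set.univ.pi fun _ => {y | |a ⬝ᵥ y| < u * √(a ⬝ᵥ a)} := by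
    ext y; simp
  rw [hset, Measure.pi_pi]
  calc ∏ _j : Fin M, (Measure.pi fun _ : ι => gaussianReal 0 1) {y | |a ⬝ᵥ y| < u * √(a ⬝ᵥ a)}
      ≤ ∏ _j : Fin M, ENNReal.ofReal u :=
        Finset.prod_le_prod' fun _ _ => pi_gaussianReal_abs_dotProduct_lt_le a
    _ = ENNReal.ofReal u ^ M := by simp

theorem pi_pi_gaussianReal_exists_lt_le {ι : Type*} [Fintype ι] (M : ℕ) (a : ι → ℝ) {D : ℝ}
    (hD : 0 ≤ D) :
    (Measure.pi fun _ : Fin M => Measure.pi fun _ : ι => gaussianReal 0 1)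
        {y | ∃ j, D * √(a ⬝ᵥ a) < |a ⬝ᵥ y j|}
      ≤ M * ENNReal.ofReal (2 * Real.exp (-D ^ 2 / 2)) := by
  have hset : {y : Fin M → ι → ℝ | ∃ j, D * √(a ⬝ᵥ a) < |a ⬝ᵥ y j|}
      = ⋃ j, Function.eval j ⁻¹' {y | D * √(a ⬝ᵥ a) < |a ⬝ᵥ y|} := by
    ext y; simp
  have hmeas : MeasurableSet {y : ι → ℝ | D * √(a ⬝ᵥ a) < |a ⬝ᵥ y|} :=
    measurableSet_lt (by fun_prop) (by unfold dotProduct; fun_prop)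
  rw [hset]
  refine (measure_iUnion_fintype_le _ _).trans ?_
  calc _ ≤ ∑ _j : Fin M, ENNReal.ofReal (2 * Real.exp (-D ^ 2 / 2)) := by
        refine Finset.sum_le_sum fun j _ => ?_
        rw [(measurePreserving_eval (fun _ : Fin M => Measure.pi fun _ : ι => gaussianReal 0 1)
          j).measure_preimage hmeas.nullMeasurableSet]
        exact pi_gaussianReal_lt_abs_dotProduct_le a hD
    _ = _ := by simp

end Gaussian

/-! ### Freezing the past; conditional subgaussianity with random coefficients -/

section Conditioning

open scoped ENNReal

variable {Ω : Type*} {m mΩ : MeasurableSpace Ω} {μ : Measure Ω}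

/-- Given `m`, the value of `X` is frozen while `Y` keeps its law `ν`, so a bound uniform in `x`
survives restriction to any `m`-measurable event. It is an instance of Tonelli for the joint law. -/
theorem measure_inter_le_of_indep {α β : Type*} [MeasurableSpace α] [MeasurableSpace β]
    [IsProbabilityMeasure μ] (hm : m ≤ mΩ) {X : Ω → α} {Y : Ω → β} {ν : Measure β}
    (hX : Measurable[m] X) (hY : Measurable Y) (hlaw : HasLaw Y ν μ)
    (hindep : Indep (MeasurableSpace.comap Y inferInstance) m μ)
    {E : Set Ω} (hE : MeasurableSet[m] E) {S : Set (α × β)} (hS : MeasurableSet S) {p : ℝ≥0∞}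
    (hp : ∀ x, ν {y | (x, y) ∈ S} ≤ p) :
    μ (E ∩ {ω | (X ω, Y ω) ∈ S}) ≤ p * μ E := by
  -- Membership in `E` is carried as an extra coordinate, so that independence of one pair of
  -- variables handles both `X` and `E`.
  let X' : Ω → α × Prop := fun ω => (X ω, ω ∈ E)
  have hX'm : Measurable[m] X' := hX.prodMk (@MeasurableSet.mem Ω E m hE)
  have hX' : Measurable X' := hX'm.mono hm le_rfl
  have hind : IndepFun X' Y μ := by
    rw [IndepFun_iff_Indep]
    exact indep_of_indep_of_le_left hindep.symm hX'm.comap_le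
  have hν : IsProbabilityMeasure ν := by
    rw [← hlaw.map_eq]; exact Measure.isProbabilityMeasure_map hY.aemeasurable
  have hprod := (indepFun_iff_map_prod_eq_prod_map_map hX'.aemeasurable hY.aemeasurable).mp hind
  rw [hlaw.map_eq] at hprod
  let S' : Set ((α × Prop) × β) := {q | q.1.2 ∧ (q.1.1, q.2) ∈ S}
  have hS' : MeasurableSet S' := by
    refine MeasurableSet.inter ?_ ?_
    · exact measurableSet_setOfPred.mpr (measurable_snd.comp measurable_fst)
    · exact hS.preimage (by fun_prop)
  have h1 : E ∩ {ω | (X ω, Y ω) ∈ S} = (fun ω => (X' ω, Y ω)) ⁻¹' S' := by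
    ext ω; simp [X', S']
  rw [h1, ← Measure.map_apply (hX'.prodMk hY) hS', hprod, Measure.prod_apply hS',
    lintegral_map (measurable_measure_prodMk_left hS') hX']
  calc ∫⁻ ω, ν (Prod.mk (X' ω) ⁻¹' S') ∂μ
      ≤ ∫⁻ ω, E.indicator (fun _ => p) ω ∂μ := by
        refine lintegral_mono fun ω => ?_
        by_cases hω : ω ∈ E
        · rw [Set.indicator_of_mem hω]
          exact (measure_mono fun y hy => hy.2).trans (hp (X ω))
        · have : Prod.mk (X' ω) ⁻¹' S' = ∅ := by
            ext y; simp [X', S', hω]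
          simp [this]
    _ = p * μ E := by
      rw [lintegral_indicator_const (hm _ hE)]

/-- The conditional expectation of exp(rX - σ²r²/2) is at most 1. This is expressed as a comparison
of two measures trimmed to `m`, which then applies to every `m`-measurable `Y` with values in [0, ∞]
and requires no integrability. -/
theorem IsCondSubgaussian.lintegral_mul_exp_const_le [IsProbabilityMeasure μ] (hm : m ≤ mΩ)
    {X : Ω → ℝ} {σ : ℝ} (h : IsCondSubgaussian μ m X σ) {Y : Ω → ℝ≥0∞} (hX : Measurable X)
    (hY : Measurable[m] Y) (r : ℝ) :
    ∫⁻ ω, Y ω * ENNReal.ofReal (Real.exp (r * X ω - σ ^ 2 * r ^ 2 / 2)) ∂μ ≤ ∫⁻ ω, Y ω ∂μ := by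
  set f : Ω → ℝ≥0∞ := fun ω => ENNReal.ofReal (Real.exp (r * X ω - σ ^ 2 * r ^ 2 / 2)) with hf
  have hfm : Measurable f := by fun_prop
  have hset : ∀ E, MeasurableSet[m] E → ∫⁻ ω in E, f ω ∂μ ≤ μ E := by
    intro E hE
    have h0 : ∀ ω, f ω = ENNReal.ofReal (Real.exp (-(σ ^ 2 * r ^ 2 / 2)))
        * ENNReal.ofReal (Real.exp (r * X ω)) := by
      intro ω
      rw [← ENNReal.ofReal_mul (Real.exp_pos _).le, ← Real.exp_add, neg_add_eq_sub]
    simp_rw [h0]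
    rw [lintegral_const_mul _ (by fun_prop),
      ← ofReal_integral_eq_lintegral_ofReal (h r).1.integrableOn
        (Filter.Eventually.of_forall fun _ => (Real.exp_pos _).le),
      ← setIntegral_condExp hm (h r).1 hE, ← ENNReal.ofReal_mul (Real.exp_pos _).le]
    have h2 : ∫ ω in E, (μ[fun ω => Real.exp (r * X ω) | m]) ω ∂μ
        ≤ ∫ _ in E, Real.exp (σ ^ 2 * r ^ 2 / 2) ∂μ :=
      setIntegral_mono_ae integrable_condExp.integrableOn (integrable_const _).integrableOn (h r).2
    rw [setIntegral_const, smul_eq_mul] at h2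
    rw [← ofReal_measureReal]
    refine ENNReal.ofReal_le_ofReal ?_
    calc _ ≤ Real.exp (-(σ ^ 2 * r ^ 2 / 2)) * (μ.real E * Real.exp (σ ^ 2 * r ^ 2 / 2)) := by
          gcongr
      _ = μ.real E := by
        rw [Real.exp_neg]
        field_simp
  have hle : (μ.withDensity f).trim hm ≤ μ.trim hm := by
    refine Measure.le_iff.mpr fun E hE => ?_
    rw [trim_measurableSet_eq hm hE, trim_measurableSet_eq hm hE, withDensity_apply _ (hm _ hE)]
    exact hset E hE
  calc ∫⁻ ω, Y ω * f ω ∂μ = ∫⁻ ω, Y ω ∂(μ.withDensity f) := by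
        rw [lintegral_withDensity_eq_lintegral_mul _ hfm (hY.mono hm le_rfl)]
        simp [mul_comm]
    _ = ∫⁻ ω, Y ω ∂((μ.withDensity f).trim hm) := (lintegral_trim hm hY).symm
    _ ≤ ∫⁻ ω, Y ω ∂(μ.trim hm) := lintegral_mono' hle le_rfl
    _ = ∫⁻ ω, Y ω ∂μ := lintegral_trim hm hY

/-- The constant case holds on each fibre of a simple `m`-measurable `s`; general `s` follows by
simple approximation and Fatou. -/
theorem IsCondSubgaussian.lintegral_mul_exp_le [IsProbabilityMeasure μ] (hm : m ≤ mΩ)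
    {X : Ω → ℝ} {σ : ℝ} (h : IsCondSubgaussian μ m X σ) {Y : Ω → ℝ≥0∞} (hX : Measurable X)
    (hY : Measurable[m] Y) {s : Ω → ℝ} (hs : Measurable[m] s) :
    ∫⁻ ω, Y ω * ENNReal.ofReal (Real.exp (s ω * X ω - σ ^ 2 * s ω ^ 2 / 2)) ∂μ
      ≤ ∫⁻ ω, Y ω ∂μ := by
  have hss : StronglyMeasurable[m] s := hs.stronglyMeasurable
  let F : ℝ → Ω → ℝ≥0∞ := fun r ω => ENNReal.ofReal (Real.exp (r * X ω - σ ^ 2 * r ^ 2 / 2))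
  have hsm : ∀ n, Measurable (hss.approx n) := fun n =>
    (@SimpleFunc.measurable _ _ m _ (hss.approx n)).mono hm le_rfl
  have hFm : ∀ n, Measurable fun ω => Y ω * F (hss.approx n ω) ω := fun n => by
    have := hsm n
    have := hY.mono hm le_rfl
    simp only [F]
    fun_prop
  have hn : ∀ n, ∫⁻ ω, Y ω * F (hss.approx n ω) ω ∂μ ≤ ∫⁻ ω, Y ω ∂μ := by
    intro n
    set g := hss.approx n with hg
    have hfib : ∀ r, MeasurableSet[m] (g ⁻¹' {r}) := fun r =>
      @SimpleFunc.measurableSet_fiber _ _ m g r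
    have hdec : ∀ Z : Ω → ℝ≥0∞, ∀ ω, Z ω
        = ∑ r ∈ (@SimpleFunc.range _ _ m g), (g ⁻¹' {r}).indicator Z ω := by
      intro Z ω
      rw [Finset.sum_eq_single (g ω)]
      · rw [Set.indicator_of_mem (by simp)]
      · intro r _ hr
        exact Set.indicator_of_notMem (fun h => hr (by simpa using h.symm)) _
      · intro hnot
        exact absurd (@SimpleFunc.mem_range_self _ _ m g ω) hnot
    have hY' : Measurable Y := hY.mono hm le_rfl
    calc ∫⁻ ω, Y ω * F (g ω) ω ∂μ
        = ∫⁻ ω, ∑ r ∈ (@SimpleFunc.range _ _ m g), (g ⁻¹' {r}).indicator Y ω * F r ω ∂μ := by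
          refine lintegral_congr fun ω => ?_
          conv_lhs => rw [hdec (fun ω => Y ω * F (g ω) ω) ω]
          refine Finset.sum_congr rfl fun r _ => ?_
          by_cases hr : ω ∈ g ⁻¹' {r}
          · rw [Set.indicator_of_mem hr, Set.indicator_of_mem hr]
            rw [Set.mem_preimage, Set.mem_singleton_iff] at hr
            rw [hr]
          · rw [Set.indicator_of_notMem hr, Set.indicator_of_notMem hr, zero_mul]
      _ = ∑ r ∈ (@SimpleFunc.range _ _ m g), ∫⁻ ω, (g ⁻¹' {r}).indicator Y ω * F r ω ∂μ := by
          refine lintegral_finsetSum _ fun r _ => ?_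
          exact (hY'.indicator (hm _ (hfib r))).mul (by simp only [F]; fun_prop)
      _ ≤ ∑ r ∈ (@SimpleFunc.range _ _ m g), ∫⁻ ω, (g ⁻¹' {r}).indicator Y ω ∂μ :=
          Finset.sum_le_sum fun r _ =>
            h.lintegral_mul_exp_const_le hm hX (hY.indicator (hfib r)) r
      _ = ∫⁻ ω, Y ω ∂μ := by
          rw [← lintegral_finsetSum _ fun r _ => hY'.indicator (hm _ (hfib r))]
          exact lintegral_congr fun ω => (hdec Y ω).symm
  calc ∫⁻ ω, Y ω * F (s ω) ω ∂μ
      = ∫⁻ ω, Filter.liminf (fun n => Y ω * F (hss.approx n ω) ω) Filter.atTop ∂μ := by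
        refine lintegral_congr fun ω => (Filter.Tendsto.liminf_eq ?_).symm
        refine ENNReal.Tendsto.const_mul ?_ (Or.inl ?_)
        · have hc : Continuous fun r : ℝ => F r ω := by
            simp only [F]
            exact ENNReal.continuous_ofReal.comp (by fun_prop)
          exact (hc.tendsto _).comp (hss.tendsto_approx ω)
        · simp only [F, ne_eq, ENNReal.ofReal_eq_zero, not_le]
          exact Real.exp_pos _
    _ ≤ Filter.liminf (fun n => ∫⁻ ω, Y ω * F (hss.approx n ω) ω ∂μ) Filter.atTop :=
        lintegral_liminf_le hFm
    _ ≤ ∫⁻ ω, Y ω ∂μ := by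
        refine (Filter.liminf_le_liminf (Filter.Eventually.of_forall hn)).trans ?_
        simp

/-- Dividing by some R > 0 with R ≥ σ, rather than by σ, allows σ = 0. -/
theorem IsCondSubgaussian.div_of_le {X : Ω → ℝ} {σ R : ℝ} (h : IsCondSubgaussian μ m X σ)
    (hσ : 0 ≤ σ) (hR : 0 < R) (hσR : σ ≤ R) : IsCondSubgaussian μ m (fun ω => X ω / R) 1 := by
  intro s
  have he : (fun ω => Real.exp (s * (X ω / R))) = fun ω => Real.exp (s / R * X ω) := by
    ext ω; congr 1; ring
  rw [he]
  refine ⟨(h (s / R)).1, (h (s / R)).2.trans (Filter.Eventually.of_forall fun ω => ?_)⟩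
  rw [Real.exp_le_exp]
  have h1 : (σ / R) ^ 2 ≤ 1 ^ 2 := by
    gcongr
    exact (div_le_one hR).mpr hσR
  have h2 : σ ^ 2 * (s / R) ^ 2 = (σ / R) ^ 2 * s ^ 2 := by field_simp
  rw [h2]
  gcongr

end Conditioning

/-! ### Self-normalized concentration by the method of mixtures -/

section SelfNormalized

open Matrix
open scoped ENNReal

theorem lintegral_exp_neg_mul_dotProduct_self {d : ℕ} {b : ℝ} (hb : 0 < b) :
    ∫⁻ v : Fin d → ℝ, ENNReal.ofReal (Real.exp (-b * (v ⬝ᵥ v)))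
      = ENNReal.ofReal (√(Real.pi / b) ^ d) := by
  have h1 : ∀ v : Fin d → ℝ, Real.exp (-b * (v ⬝ᵥ v)) = ∏ i, Real.exp (-b * v i ^ 2) := by
    intro v
    rw [← Real.exp_sum, dotProduct, Finset.mul_sum]
    simp only [sq]
  simp_rw [h1]
  rw [volume_pi, ← ofReal_integral_eq_lintegral_ofReal
    (Integrable.fintype_prod fun _ => integrable_exp_neg_mul_sq hb)
    (Filter.Eventually.of_forall fun v => Finset.prod_nonneg fun _ _ => (Real.exp_pos _).le)]
  rw [integral_fintype_prod_eq_pow (fun x : ℝ => Real.exp (-b * x ^ 2)), integral_gaussian,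
    Fintype.card_fin]

/-- A lower bound for the Gaussian mixture of `exp (⟨v, s⟩ - vᵀ V v / 2)` over `v`. -/
theorem le_lintegral_exp_gramMatrix {d : ℕ} {lam b : ℝ} (hlam : 0 < lam) {x : ℕ → Fin d → ℝ}
    {t : ℕ} (hx : ∀ τ < t, x τ ⬝ᵥ x τ ≤ b) (hb : 0 ≤ b) (s : Fin d → ℝ) :
    ENNReal.ofReal (Real.exp (sqWidth lam x t s / 2))
        * ENNReal.ofReal (√(Real.pi / ((lam + t * b) / 2)) ^ d)
      ≤ ∫⁻ v : Fin d → ℝ,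
          ENNReal.ofReal (Real.exp (v ⬝ᵥ s - v ⬝ᵥ (gramMatrix lam x t *ᵥ v) / 2)) := by
  set V := gramMatrix lam x t with hV
  -- Completing the square: after translation by c = V⁻¹s the exponent is sᵀV⁻¹s/2 - vᵀVv/2.
  -- Bounding V by λ + tb then leaves an isotropic Gaussian integral.
  set c := V⁻¹ *ᵥ s with hc
  have hVc : V *ᵥ c = s := gramMatrix_mulVec_inv_mulVec hlam s
  have hpos : 0 < (lam + t * b) / 2 := by positivity
  rw [← lintegral_exp_neg_mul_dotProduct_self hpos, ← lintegral_const_mul _ (by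
    unfold dotProduct; fun_prop),
    ← lintegral_add_right_eq_self (fun v : Fin d → ℝ =>
      ENNReal.ofReal (Real.exp (v ⬝ᵥ s - v ⬝ᵥ (V *ᵥ v) / 2))) c]
  refine lintegral_mono fun v => ?_
  rw [← ENNReal.ofReal_mul (Real.exp_pos _).le, ← Real.exp_add]
  refine ENNReal.ofReal_le_ofReal (Real.exp_le_exp.mpr ?_)
  have h1 := dotProduct_gramMatrix_mulVec_self_le (lam := lam) hx v
  have h2 : c ⬝ᵥ (V *ᵥ v) = v ⬝ᵥ s := by
    rw [← hVc, hV, dotProduct_gramMatrix_mulVec, dotProduct_gramMatrix_mulVec, dotProduct_comm c v]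
    simp only [mul_comm]
  have h3 : sqWidth lam x t s = c ⬝ᵥ s := by
    rw [sqWidth, ← hV, ← hc, dotProduct_comm]
  rw [mulVec_add, hVc, dotProduct_add, add_dotProduct, add_dotProduct, h2, h3]
  rw [← hV] at h1
  linarith

theorem filtration_le_of_lt {Ω : Type*} {ℱ 𝒢 : ℕ → MeasurableSpace Ω} (hi : ∀ t, ℱ t ≤ 𝒢 t ∧ 𝒢 t ≤ ℱ (t + 1)) {s t : ℕ} (hst : s < t) :
    𝒢 s ≤ ℱ t := by
  induction t, hst using Nat.le_induction with
  | base => exact (hi s).2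
  | succ t _ ih => exact ih.trans ((hi t).1.trans (hi t).2)

theorem filtration_mono {Ω : Type*} {ℱ 𝒢 : ℕ → MeasurableSpace Ω} (hi : ∀ t, ℱ t ≤ 𝒢 t ∧ 𝒢 t ≤ ℱ (t + 1)) {s t : ℕ} (hst : s ≤ t) :
    ℱ s ≤ ℱ t := by
  rcases hst.eq_or_lt with rfl | h
  · exact le_rfl
  · exact (hi s).1.trans (filtration_le_of_lt hi h)

variable {Ω : Type*} [mΩ : MeasurableSpace Ω] {μ : Measure Ω} {d T : ℕ}
  {ℱ 𝒢 : ℕ → MeasurableSpace Ω} {x : ℕ → Ω → Fin d → ℝ} {η : ℕ → Ω → ℝ}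

/-- For a fixed direction v this is an exponential supermartingale: the coefficient v ⬝ᵥ x_t is
known at `𝒢 t`, before the noise. -/
theorem lintegral_exp_sum_le_one [IsProbabilityMeasure μ] (hle : ∀ t, ℱ t ≤ mΩ ∧ 𝒢 t ≤ mΩ)
    (hi : ∀ t, ℱ t ≤ 𝒢 t ∧ 𝒢 t ≤ ℱ (t + 1)) (hx : ∀ t < T, Measurable[𝒢 t] (x t))
    (hη : ∀ t < T, Measurable[ℱ (t + 1)] (η t))
    (hsub : ∀ t < T, IsCondSubgaussian μ (𝒢 t) (η t) 1) (v : Fin d → ℝ) {t : ℕ} (ht : t ≤ T) :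
    ∫⁻ ω, ENNReal.ofReal (Real.exp (∑ τ ∈ Finset.range t,
      ((v ⬝ᵥ x τ ω) * η τ ω - (v ⬝ᵥ x τ ω) ^ 2 / 2))) ∂μ ≤ 1 := by
  induction t with
  | zero => simp
  | succ t ih =>
    have hdot : ∀ τ < T, Measurable[𝒢 τ] fun ω => v ⬝ᵥ x τ ω := fun τ hτ =>
      (show Measurable fun z : Fin d → ℝ => v ⬝ᵥ z by unfold dotProduct; fun_prop).comp (hx τ hτ)
    have hYm : Measurable[𝒢 t] fun ω => ENNReal.ofReal (Real.exp (∑ τ ∈ Finset.range t,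
        ((v ⬝ᵥ x τ ω) * η τ ω - (v ⬝ᵥ x τ ω) ^ 2 / 2))) := by
      refine ENNReal.measurable_ofReal.comp (Real.measurable_exp.comp ?_)
      refine Finset.measurable_sum _ fun τ hτ => ?_
      have hτt := Finset.mem_range.mp hτ
      have h1 : Measurable[𝒢 t] fun ω => v ⬝ᵥ x τ ω :=
        (hdot τ (by omega)).mono ((filtration_le_of_lt hi hτt).trans (hi t).1) le_rfl
      have h2 : Measurable[𝒢 t] (η τ) :=
        (hη τ (by omega)).mono ((filtration_mono hi (by omega)).trans (hi t).1) le_rfl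
      exact (h1.mul h2).sub ((h1.pow_const 2).div_const 2)
    have hηm : Measurable (η t) := (hη t ht).mono (hle (t + 1)).1 le_rfl
    have hstep := (hsub t ht).lintegral_mul_exp_le (hle t).2 hηm hYm (hdot t ht)
    refine le_trans (le_of_eq (lintegral_congr fun ω => ?_)) (hstep.trans (ih (by omega)))
    rw [← ENNReal.ofReal_mul (Real.exp_pos _).le, ← Real.exp_add, Finset.sum_range_succ, one_pow,
      one_mul]

/-- Integrate the supermartingale over v against the weight exp(-λ|v|²/2), which supplies the λI
part of the Gram matrix, and exchange the integrals. The right-hand side is the ratio of the two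
isotropic Gaussian integrals, with precisions λ and λ + tb. -/
theorem lintegral_exp_sqWidth_le [IsProbabilityMeasure μ] (hle : ∀ t, ℱ t ≤ mΩ ∧ 𝒢 t ≤ mΩ)
    (hi : ∀ t, ℱ t ≤ 𝒢 t ∧ 𝒢 t ≤ ℱ (t + 1)) (hx : ∀ t < T, Measurable[𝒢 t] (x t))
    (hη : ∀ t < T, Measurable[ℱ (t + 1)] (η t))
    (hsub : ∀ t < T, IsCondSubgaussian μ (𝒢 t) (η t) 1) {lam b : ℝ} (hlam : 0 < lam) (hb : 0 ≤ b)
    (hxb : ∀ t < T, ∀ ω, x t ω ⬝ᵥ x t ω ≤ b) {t : ℕ} (ht : t ≤ T) :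
    ∫⁻ ω, ENNReal.ofReal (Real.exp (sqWidth lam (fun τ => x τ ω) t
        (∑ τ ∈ Finset.range t, η τ ω • x τ ω) / 2)) ∂μ
      ≤ ENNReal.ofReal (√(1 + t * b / lam) ^ d) := by
  set c := ENNReal.ofReal (√(Real.pi / ((lam + t * b) / 2)) ^ d) with hc
  have hcpos : 0 < √(Real.pi / ((lam + t * b) / 2)) ^ d := by positivity
  have hc0 : c ≠ 0 := by rw [hc, ne_eq, ENNReal.ofReal_eq_zero, not_le]; exact hcpos
  have hctop : c ≠ ∞ := ENNReal.ofReal_ne_top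
  let G : Ω → (Fin d → ℝ) → ℝ≥0∞ := fun ω v => ENNReal.ofReal (Real.exp (-(lam / 2) * (v ⬝ᵥ v))) *
    ENNReal.ofReal (Real.exp (∑ τ ∈ Finset.range t,
      ((v ⬝ᵥ x τ ω) * η τ ω - (v ⬝ᵥ x τ ω) ^ 2 / 2)))
  have hxm : ∀ τ ∈ Finset.range t, Measurable (x τ) := fun τ hτ =>
    (hx τ (by have := Finset.mem_range.mp hτ; omega)).mono (hle τ).2 le_rfl
  have hηm : ∀ τ ∈ Finset.range t, Measurable (η τ) := fun τ hτ =>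
    (hη τ (by have := Finset.mem_range.mp hτ; omega)).mono (hle (τ + 1)).1 le_rfl
  have hG : Measurable (Function.uncurry G) := by
    have hd : Measurable fun p : (Fin d → ℝ) × (Fin d → ℝ) => p.1 ⬝ᵥ p.2 := by
      unfold dotProduct; fun_prop
    refine Measurable.mul (f := fun p : Ω × (Fin d → ℝ) =>
      ENNReal.ofReal (Real.exp (-(lam / 2) * (p.2 ⬝ᵥ p.2)))) ?_ ?_
    · have : Measurable fun p : Ω × (Fin d → ℝ) => p.2 ⬝ᵥ p.2 :=
        hd.comp (measurable_snd.prodMk measurable_snd)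
      fun_prop
    · refine ENNReal.measurable_ofReal.comp (Real.measurable_exp.comp ?_)
      refine Finset.measurable_sum _ fun τ hτ => ?_
      have h1 : Measurable fun p : Ω × (Fin d → ℝ) => p.2 ⬝ᵥ x τ p.1 :=
        hd.comp (measurable_snd.prodMk ((hxm τ hτ).comp measurable_fst))
      exact (h1.mul ((hηm τ hτ).comp measurable_fst)).sub ((h1.pow_const 2).div_const 2)
  have hlow : ∀ ω, ENNReal.ofReal (Real.exp (sqWidth lam (fun τ => x τ ω) t
      (∑ τ ∈ Finset.range t, η τ ω • x τ ω) / 2)) * c ≤ ∫⁻ v, G ω v := by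
    intro ω
    refine (le_lintegral_exp_gramMatrix hlam (fun τ hτ => hxb τ (by omega) ω) hb _).trans
      (le_of_eq (lintegral_congr fun v => ?_))
    simp only [G]
    rw [← ENNReal.ofReal_mul (Real.exp_pos _).le, ← Real.exp_add, dotProduct_gramMatrix_mulVec,
      dotProduct_sum, Finset.sum_sub_distrib, ← Finset.sum_div]
    congr 2
    simp only [dotProduct_smul, smul_eq_mul, dotProduct_comm (x _ ω) v, sq,
      mul_comm (η _ ω)]
    ring
  have htot : (∫⁻ ω, ENNReal.ofReal (Real.exp (sqWidth lam (fun τ => x τ ω) t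
      (∑ τ ∈ Finset.range t, η τ ω • x τ ω) / 2)) ∂μ) * c
      ≤ ENNReal.ofReal (√(Real.pi / (lam / 2)) ^ d) := by
    rw [← lintegral_mul_const' _ _ hctop]
    calc _ ≤ ∫⁻ ω, (∫⁻ v, G ω v) ∂μ := lintegral_mono hlow
      _ = ∫⁻ v, (∫⁻ ω, G ω v ∂μ) := lintegral_lintegral_swap hG.aemeasurable
      _ ≤ ∫⁻ v : Fin d → ℝ, ENNReal.ofReal (Real.exp (-(lam / 2) * (v ⬝ᵥ v))) := by
        refine lintegral_mono fun v => ?_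
        simp only [G]
        rw [lintegral_const_mul' _ _ ENNReal.ofReal_ne_top]
        exact mul_le_of_le_one_right' (lintegral_exp_sum_le_one hle hi hx hη hsub v ht)
      _ = _ := lintegral_exp_neg_mul_dotProduct_self (by positivity)
  have hratio : ENNReal.ofReal (√(Real.pi / (lam / 2)) ^ d)
      = ENNReal.ofReal (√(1 + t * b / lam) ^ d) * c := by
    rw [hc, ← ENNReal.ofReal_mul (by positivity), ← mul_pow, ← Real.sqrt_mul (by positivity)]
    congr 3
    field_simp
  rw [hratio] at htot
  exact (ENNReal.mul_le_mul_iff_left hc0 hctop).mp htot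

/-- The self-normalized tail bound for a martingale transform. -/
theorem measure_lt_sqWidth_le [IsProbabilityMeasure μ] (hle : ∀ t, ℱ t ≤ mΩ ∧ 𝒢 t ≤ mΩ)
    (hi : ∀ t, ℱ t ≤ 𝒢 t ∧ 𝒢 t ≤ ℱ (t + 1)) (hx : ∀ t < T, Measurable[𝒢 t] (x t))
    (hη : ∀ t < T, Measurable[ℱ (t + 1)] (η t))
    (hsub : ∀ t < T, IsCondSubgaussian μ (𝒢 t) (η t) 1) {lam b : ℝ} (hlam : 0 < lam) (hb : 0 ≤ b)
    (hxb : ∀ t < T, ∀ ω, x t ω ⬝ᵥ x t ω ≤ b) {t : ℕ} (ht : t ≤ T) {p : ℝ} (hp : 0 < p)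
    (hmeas : Measurable fun ω => sqWidth lam (fun τ => x τ ω) t
        (∑ τ ∈ Finset.range t, η τ ω • x τ ω)) :
    μ {ω | 2 * Real.log (1 / p) + d * Real.log (1 + t * b / lam)
        < sqWidth lam (fun τ => x τ ω) t (∑ τ ∈ Finset.range t, η τ ω • x τ ω)}
      ≤ ENNReal.ofReal p := by
  set w := fun ω => sqWidth lam (fun τ => x τ ω) t (∑ τ ∈ Finset.range t, η τ ω • x τ ω) with hw
  set Q := √(1 + t * b / lam) ^ d with hQ
  have hQpos : 0 < Q := by positivity
  have hlogQ : Real.log Q = d * Real.log (1 + t * b / lam) / 2 := by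
    rw [hQ, Real.log_pow, Real.log_sqrt (by positivity)]
    ring
  -- The threshold is tuned so that Markov's inequality, applied to a variable of mean at most Q at
  -- level Q/p, leaves p.
  have hthr : Real.exp ((2 * Real.log (1 / p) + d * Real.log (1 + t * b / lam)) / 2) = Q / p := by
    rw [add_div, ← hlogQ, Real.exp_add, Real.exp_log hQpos, mul_div_cancel_left₀ _ two_ne_zero,
      Real.exp_log (by positivity)]
    field_simp
  have hsubset : {ω | 2 * Real.log (1 / p) + d * Real.log (1 + t * b / lam) < w ω}
      ⊆ {ω | ENNReal.ofReal (Q / p) ≤ ENNReal.ofReal (Real.exp (w ω / 2))} := by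
    intro ω hω
    rw [Set.mem_ofPred_eq] at hω ⊢
    rw [← hthr]
    refine ENNReal.ofReal_le_ofReal (Real.exp_le_exp.mpr ?_)
    linarith
  refine (measure_mono hsubset).trans ?_
  have hmk := meas_ge_le_lintegral_div (μ := μ) (f := fun ω => ENNReal.ofReal (Real.exp (w ω / 2)))
    (by fun_prop) (ε := ENNReal.ofReal (Q / p))
    (by rw [ne_eq, ENNReal.ofReal_eq_zero, not_le]; positivity) ENNReal.ofReal_ne_top
  refine hmk.trans ?_
  refine (ENNReal.div_le_div_right
    (lintegral_exp_sqWidth_le hle hi hx hη hsub hlam hb hxb ht) _).trans ?_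
  rw [← ENNReal.ofReal_div_of_pos (by positivity)]
  refine ENNReal.ofReal_le_ofReal (le_of_eq ?_)
  rw [← hQ]
  field_simp

end SelfNormalized

/-! ### Least-squares predictions as linear forms; measurability -/

open Matrix in
/-- The coefficients of the regularized least-squares prediction at `y` as a linear function of the
targets of the `d` warm-start features and of the rounds `τ < t`. -/
noncomputable def predictionCoef {d : ℕ} (lam : ℝ) (x : ℕ → Fin d → ℝ) (t : ℕ) (y : Fin d → ℝ) :
    Fin d ⊕ Fin t → ℝ :=
  Sum.elim (fun i => √lam * ((gramMatrix lam x t)⁻¹ *ᵥ y) i)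
    fun τ => x τ ⬝ᵥ ((gramMatrix lam x t)⁻¹ *ᵥ y)

section Prediction

open Matrix

/-- The map from y to its coefficients carries the V⁻¹ inner product to the Euclidean one. Hence,
for standard Gaussian targets, the variance of a prediction is the squared width. -/
theorem predictionCoef_dotProduct {d : ℕ} {lam : ℝ} {x : ℕ → Fin d → ℝ} {t : ℕ} (hlam : 0 < lam)
    (y y' : Fin d → ℝ) :
    predictionCoef lam x t y ⬝ᵥ predictionCoef lam x t y'
      = y ⬝ᵥ ((gramMatrix lam x t)⁻¹ *ᵥ y') := by
  rw [dotProduct_eq_of_gramMatrix (x := x) (t := t) hlam y, dotProduct, Fintype.sum_sum_type,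
    Finset.sum_range]
  simp only [predictionCoef, Sum.elim_inl, Sum.elim_inr]
  congr 1
  rw [dotProduct, Finset.mul_sum]
  refine Finset.sum_congr rfl fun i _ => ?_
  rw [mul_mul_mul_comm, Real.mul_self_sqrt hlam.le]

theorem predictionCoef_dotProduct_self {d : ℕ} {lam : ℝ} {x : ℕ → Fin d → ℝ} {t : ℕ}
    (hlam : 0 < lam) (y : Fin d → ℝ) :
    predictionCoef lam x t y ⬝ᵥ predictionCoef lam x t y = sqWidth lam x t y :=
  predictionCoef_dotProduct hlam y y

theorem abs_dotProduct_inv_mulVec_le {d : ℕ} {lam : ℝ} {x : ℕ → Fin d → ℝ} {t : ℕ}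
    (hlam : 0 < lam) (y y' : Fin d → ℝ) :
    |y ⬝ᵥ ((gramMatrix lam x t)⁻¹ *ᵥ y')| ≤ √(sqWidth lam x t y) * √(sqWidth lam x t y') := by
  rw [← Real.sqrt_mul (sqWidth_nonneg hlam y)]
  refine Real.abs_le_sqrt ?_
  have h := dotProduct_sq_le (predictionCoef lam x t y) (predictionCoef lam x t y')
  rwa [predictionCoef_dotProduct hlam, predictionCoef_dotProduct_self hlam,
    predictionCoef_dotProduct_self hlam] at h

theorem real_inner_eq_dotProduct {d : ℕ} (x y : EuclideanSpace ℝ (Fin d)) :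
    inner ℝ x y = x.ofLp ⬝ᵥ y.ofLp := by
  rw [EuclideanSpace.inner_eq_star_dotProduct, star_trivial, dotProduct_comm]

section Measurability

variable {Ω : Type*} {m : MeasurableSpace Ω} {d : ℕ} {lam : ℝ} {x : ℕ → Ω → Fin d → ℝ} {t : ℕ}

theorem measurable_gramMatrix_inv_apply (hx : ∀ τ < t, Measurable (x τ)) (i j : Fin d) :
    Measurable fun ω => (gramMatrix lam (fun τ => x τ ω) t)⁻¹ i j := by
  have hV : Measurable fun ω i j => gramMatrix lam (fun τ => x τ ω) t i j := by
    refine measurable_pi_lambda _ fun i => measurable_pi_lambda _ fun j => ?_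
    simp only [gramMatrix, Matrix.add_apply, Matrix.sum_apply, vecMulVec_apply]
    refine measurable_const.add (Finset.measurable_sum _ fun τ hτ => ?_)
    have := hx τ (Finset.mem_range.mp hτ)
    exact (measurable_pi_iff.mp this i).mul (measurable_pi_iff.mp this j)
  -- The inverse is the adjugate divided by the determinant; this is measurable on all matrices,
  -- including singular ones.
  have hf : Measurable fun V : Fin d → Fin d → ℝ => (Matrix.of V)⁻¹ i j := by
    have h1 : Continuous fun V : Fin d → Fin d → ℝ => (Matrix.of V).det :=
      Continuous.matrix_det continuous_id
    have h2 : Continuous fun V : Fin d → Fin d → ℝ => (Matrix.of V).adjugate i j :=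
      (Continuous.matrix_adjugate (continuous_id (X := Matrix (Fin d) (Fin d) ℝ))).matrix_elem i j
    simp only [Matrix.inv_def, Matrix.smul_apply, Ring.inverse_eq_inv', smul_eq_mul]
    exact h1.measurable.inv.mul h2.measurable
  exact hf.comp hV

theorem measurable_gramMatrix_inv_mulVec (hx : ∀ τ < t, Measurable (x τ)) {y : Ω → Fin d → ℝ}
    (hy : Measurable y) :
    Measurable fun ω => (gramMatrix lam (fun τ => x τ ω) t)⁻¹ *ᵥ y ω := by
  refine measurable_pi_lambda _ fun i => ?_
  simp only [mulVec, dotProduct]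
  exact Finset.measurable_sum _ fun j _ =>
    (measurable_gramMatrix_inv_apply hx i j).mul (measurable_pi_iff.mp hy j)

theorem measurable_dotProduct {y z : Ω → Fin d → ℝ} (hy : Measurable y) (hz : Measurable z) :
    Measurable fun ω => y ω ⬝ᵥ z ω := by
  simp only [dotProduct]
  exact Finset.measurable_sum _ fun j _ =>
    (measurable_pi_iff.mp hy j).mul (measurable_pi_iff.mp hz j)

theorem measurable_sqWidth (hx : ∀ τ < t, Measurable (x τ)) {y : Ω → Fin d → ℝ}
    (hy : Measurable y) : Measurable fun ω => sqWidth lam (fun τ => x τ ω) t (y ω) :=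
  measurable_dotProduct hy (measurable_gramMatrix_inv_mulVec hx hy)

theorem measurable_predictionCoef (hx : ∀ τ < t, Measurable (x τ)) {y : Ω → Fin d → ℝ}
    (hy : Measurable y) : Measurable fun ω => predictionCoef lam (fun τ => x τ ω) t (y ω) := by
  have hz := measurable_gramMatrix_inv_mulVec (lam := lam) hx hy
  refine measurable_pi_lambda _ fun i => ?_
  rcases i with i | τ
  · exact (measurable_pi_iff.mp hz i).const_mul _
  · exact measurable_dotProduct (hx τ τ.2) hz

end Measurability

end Prediction

/-! ### The regressors of the algorithm and the error of the ridge estimate -/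

namespace BanditTrajectory

open Matrix

variable {Ω 𝒜 : Type*} {d : ℕ} {h : BanditTrajectory Ω 𝒜 d} {lam : ℝ} {t : ℕ} {ω : Ω}

/-- The coordinates of the chosen feature vectors. -/
def history (h : BanditTrajectory Ω 𝒜 d) (ω : Ω) (τ : ℕ) : Fin d → ℝ := (h.chosen τ ω).ofLp

/-- Test the normal equations against z = V⁻¹x: one side becomes zᵀVw = ⟨x, w⟩, the other pairs the
coefficients with the targets. -/
theorem inner_eq_predictionCoef_dotProduct (hlam : 0 < lam) {y : Fin d ⊕ Fin t → ℝ}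
    {w : EuclideanSpace ℝ (Fin d)} (hw : IsMinOn (h.noiseLoss lam t ω y) Set.univ w)
    (x : EuclideanSpace ℝ (Fin d)) :
    inner ℝ x w = predictionCoef lam (h.history ω) t x.ofLp ⬝ᵥ y := by
  let φ : Fin d ⊕ Fin t → EuclideanSpace ℝ (Fin d) :=
    Sum.elim (fun i => √lam • EuclideanSpace.single i (1 : ℝ)) fun τ => h.chosen τ ω
  have hloss : h.noiseLoss lam t ω y = fun v => ∑ i ∈ Finset.univ, (inner ℝ (φ i) v - y i) ^ 2 := by
    ext v
    rw [Fintype.sum_sum_type]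
    rfl
  rw [hloss] at hw
  set z : EuclideanSpace ℝ (Fin d) :=
    WithLp.toLp 2 ((gramMatrix lam (h.history ω) t)⁻¹ *ᵥ x.ofLp) with hz
  have hne := sum_mul_residual_eq_zero_of_isMinOn Finset.univ φ y hw z
  have hcoef : ∀ i, inner ℝ (φ i) z = predictionCoef lam (h.history ω) t x.ofLp i := by
    rintro (i | τ)
    · simp [φ, predictionCoef, real_inner_smul_left, hz, EuclideanSpace.inner_single_left]
    · simp only [φ, predictionCoef, Sum.elim_inr, hz]
      rw [real_inner_eq_dotProduct]
      rfl
  have hinl : ∀ i, inner ℝ (φ (Sum.inl i)) w = √lam * w i := by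
    intro i
    simp [φ, real_inner_smul_left, EuclideanSpace.inner_single_left]
  simp only [mul_sub, Finset.sum_sub_distrib, hcoef, sub_eq_zero] at hne
  rw [dotProduct, ← hne, real_inner_eq_dotProduct,
    dotProduct_eq_of_gramMatrix (x := h.history ω) (t := t) hlam x.ofLp, Fintype.sum_sum_type,
    Finset.sum_range]
  congr 1
  · rw [dotProduct, Finset.mul_sum]
    refine Finset.sum_congr rfl fun i _ => ?_
    rw [hinl, predictionCoef, Sum.elim_inl, mul_mul_mul_comm, Real.mul_self_sqrt hlam.le]
  · refine Finset.sum_congr rfl fun τ _ => ?_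
    rw [predictionCoef, Sum.elim_inr]
    simp only [φ, Sum.elim_inr]
    rw [real_inner_eq_dotProduct]
    rfl

/-- The penalty λ‖v‖² is the loss of the warm-start features with targets 0, so the prediction
formula for noise regressors also covers the reward estimator. -/
theorem ridgeLoss_eq_noiseLoss (hlam : 0 ≤ lam) (θ : EuclideanSpace ℝ (Fin d)) :
    h.ridgeLoss θ lam t ω = h.noiseLoss lam t ω (Sum.elim 0 fun τ => h.reward θ τ ω) := by
  ext v
  rw [ridgeLoss, noiseLoss, add_comm, EuclideanSpace.real_norm_sq_eq, Finset.mul_sum,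
    Finset.sum_range]
  congr 1
  refine Finset.sum_congr rfl fun i _ => ?_
  simp [real_inner_smul_left, EuclideanSpace.inner_single_left, mul_pow, Real.sq_sqrt hlam]

/-- With z = V⁻¹x, the error is a noise term R(S ⬝ᵥ z) minus the regularization bias λ(z ⬝ᵥ θ). The
first is bounded by Cauchy–Schwarz in the V⁻¹ geometry, the second by λ|z|² ≤ xᵀV⁻¹x. -/
theorem abs_inner_sub_inner_le (hlam : 0 < lam) {θ v : EuclideanSpace ℝ (Fin d)}
    (hv : IsMinOn (h.ridgeLoss θ lam t ω) Set.univ v) {W R q : ℝ} (hθ : ‖θ‖ ≤ W) (hR : 0 < R)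
    (hq : sqWidth lam (h.history ω) t
      (∑ τ ∈ Finset.range t, (h.noise τ ω / R) • h.history ω τ) ≤ q)
    (x : EuclideanSpace ℝ (Fin d)) :
    |inner ℝ x v - inner ℝ x θ|
      ≤ (R * √q + √lam * W) * √(sqWidth lam (h.history ω) t x.ofLp) := by
  set X := h.history ω with hX
  set z := (gramMatrix lam X t)⁻¹ *ᵥ x.ofLp with hz
  set S := ∑ τ ∈ Finset.range t, (h.noise τ ω / R) • X τ with hS
  rw [ridgeLoss_eq_noiseLoss hlam.le] at hv
  have h1 : inner ℝ x v - inner ℝ x θ = R * (S ⬝ᵥ z) - lam * (z ⬝ᵥ θ.ofLp) := by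
    rw [inner_eq_predictionCoef_dotProduct hlam hv, real_inner_eq_dotProduct x θ,
      dotProduct_eq_of_gramMatrix (x := X) (t := t) hlam x.ofLp θ.ofLp, dotProduct,
      Fintype.sum_sum_type, hS, sum_dotProduct, Finset.sum_range, Finset.sum_range, Finset.mul_sum]
    simp only [Sum.elim_inl, Pi.zero_apply, mul_zero, Finset.sum_const_zero, zero_add,
      Sum.elim_inr, predictionCoef]
    rw [← hX, ← hz, sub_add_eq_sub_sub_swap, ← Finset.sum_sub_distrib]
    congr 1
    refine Finset.sum_congr rfl fun τ _ => ?_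
    rw [reward, real_inner_eq_dotProduct, smul_dotProduct, smul_eq_mul]
    change X τ ⬝ᵥ z * (X τ ⬝ᵥ θ.ofLp + h.noise τ ω) - X τ ⬝ᵥ z * X τ ⬝ᵥ θ.ofLp = _
    field_simp
    ring
  have h2 : |S ⬝ᵥ z| ≤ √q * √(sqWidth lam X t x.ofLp) :=
    (abs_dotProduct_inv_mulVec_le hlam S x.ofLp).trans
      (mul_le_mul_of_nonneg_right (Real.sqrt_le_sqrt hq) (Real.sqrt_nonneg _))
  have hW : 0 ≤ W := (norm_nonneg θ).trans hθ
  have hw0 := sqWidth_nonneg (x := X) (t := t) hlam x.ofLp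
  have h3 : |lam * (z ⬝ᵥ θ.ofLp)| ≤ √lam * W * √(sqWidth lam X t x.ofLp) := by
    refine abs_le_of_sq_le_sq ?_ (by positivity)
    have h4 := dotProduct_sq_le z θ.ofLp
    have h5 : θ.ofLp ⬝ᵥ θ.ofLp ≤ W ^ 2 := by
      rw [← real_inner_eq_dotProduct, real_inner_self_eq_norm_sq]
      gcongr
    have h6 := mul_dotProduct_inv_mulVec_le (x := X) (t := t) hlam x.ofLp
    rw [← hz] at h6
    have hzz := dotProduct_self_nonneg' z
    rw [mul_pow, mul_pow, mul_pow, Real.sq_sqrt hlam.le, Real.sq_sqrt hw0]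
    calc lam ^ 2 * (z ⬝ᵥ θ.ofLp) ^ 2 ≤ lam ^ 2 * ((z ⬝ᵥ z) * W ^ 2) := by
          gcongr
          exact h4.trans (mul_le_mul_of_nonneg_left h5 hzz)
      _ = lam * W ^ 2 * (lam * (z ⬝ᵥ z)) := by ring
      _ ≤ lam * W ^ 2 * sqWidth lam X t x.ofLp := by gcongr
  calc |inner ℝ x v - inner ℝ x θ| ≤ |R * (S ⬝ᵥ z)| + |lam * (z ⬝ᵥ θ.ofLp)| := by
        rw [h1]; exact abs_sub _ _
    _ ≤ R * (√q * √(sqWidth lam X t x.ofLp)) + √lam * W * √(sqWidth lam X t x.ofLp) := by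
        rw [abs_mul, abs_of_pos hR]
        gcongr
    _ = _ := by ring

end BanditTrajectory

/-! ### Optimism and size of the bonus in one round -/

section Events

open Matrix
open scoped ENNReal

theorem measurableSet_isOptimal {Ω 𝒜 : Type*} {m : MeasurableSpace Ω} {acts : Ω → Finset 𝒜}
    {g : 𝒜 → Ω → ℝ} (ha : ∀ a, MeasurableSet {ω | a ∈ acts ω}) (hg : ∀ a, Measurable (g a))
    (f : ℕ → 𝒜) (n : ℕ) :
    MeasurableSet {ω | f n ∈ acts ω ∧ ∀ k, f k ∈ acts ω → g (f k) ω ≤ g (f n) ω} := by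
  rw [Set.ofPred_and, Set.ofPred_forall]
  refine (ha (f n)).inter ?_
  refine MeasurableSet.iInter fun k => ?_
  simp only [imp_iff_not_or]
  exact (ha (f k)).compl.union (measurableSet_le (hg _) (hg _))

theorem tsum_indicator_mem_le_card {𝒜 : Type*} (L : Set 𝒜) (s : Finset 𝒜) :
    ∑' a : L, (s : Set 𝒜).indicator (1 : 𝒜 → ℝ≥0∞) a ≤ s.card := by
  refine (ENNReal.tsum_comp_le_tsum_of_injective Subtype.val_injective
    ((s : Set 𝒜).indicator (1 : 𝒜 → ℝ≥0∞))).trans ?_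
  rw [tsum_eq_sum (s := s) fun a ha => Set.indicator_of_notMem (by simpa using ha) _,
    Finset.sum_congr rfl fun a ha => Set.indicator_of_mem (by simpa using ha) _]
  simp

variable {Ω 𝒜 : Type*} [mΩ : MeasurableSpace Ω] {μ : Measure Ω} {d M : ℕ}
  {h : BanditTrajectory Ω 𝒜 d} {s : ACBState Ω d M} {ℱ 𝒢 : ℕ → MeasurableSpace Ω}
  {T A : ℕ} {B σ : ℝ} {θ : EuclideanSpace ℝ (Fin d)} {lam β : ℝ} {t : ℕ}

theorem IsLinearBandit.measurable_history (hB : IsLinearBandit μ h ℱ 𝒢 T A B σ)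
    (hmem : ∀ ω, h.action t ω ∈ h.actions t ω) (ht : t < T) :
    Measurable[𝒢 t] fun ω => h.history ω t := by
  intro U hU
  have hset : (fun ω => h.history ω t) ⁻¹' U
      = ⋃ a ∈ (⋃ t, ⋃ ω, (h.actions t ω : Set 𝒜)),
          {ω | h.action t ω = a} ∩ (fun ω => (h.feature t ω a).ofLp) ⁻¹' U := by
    ext ω
    simp only [Set.mem_preimage, Set.mem_iUnion, Set.mem_inter_iff, Set.mem_ofPred_eq,
      Finset.mem_coe, exists_prop, BanditTrajectory.history, BanditTrajectory.chosen]
    constructor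
    · intro hω
      exact ⟨h.action t ω, ⟨t, ω, hmem ω⟩, rfl, hω⟩
    · rintro ⟨a, _, rfl, hω⟩
      exact hω
  rw [hset]
  refine MeasurableSet.biUnion hB.countable_labels fun a _ => ?_
  refine MeasurableSet.inter (hB.action_measurable t ht a) ?_
  have hm : Measurable fun x : EuclideanSpace ℝ (Fin d) => x.ofLp := by fun_prop
  exact (hB.interleaved t).1 _ ((hm.comp (hB.feature_measurable t ht a)) hU)

/-- For a fixed label the coefficients are `ℱ t`-measurable and the targets are independent of `ℱ
t`, so a Gaussian estimate uniform in the coefficients suffices. -/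
theorem measure_inter_weight_le [IsProbabilityMeasure μ] (hB : IsLinearBandit μ h ℱ 𝒢 T A B σ)
    (hA : IsRerandomizedACB μ h s ℱ 𝒢 T θ lam β) (ht : t < T) (a : 𝒜)
    {E : Set Ω} (hE : MeasurableSet[ℱ t] E)
    {S : Set ((Fin d ⊕ Fin t → ℝ) × (Fin M → Fin d ⊕ Fin t → ℝ))} (hS : MeasurableSet S)
    {p : ℝ≥0∞} (hp : ∀ c, (Measure.pi fun _ : Fin M => Measure.pi fun _ : Fin d ⊕ Fin t =>
      gaussianReal 0 1) {y | (c, y) ∈ S} ≤ p) :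
    μ (E ∩ {ω | (predictionCoef lam (h.history ω) t (h.feature t ω a).ofLp, s.target t ω) ∈ S})
      ≤ p * μ E := by
  refine measure_inter_le_of_indep (hB.le_ambient t).1 ?_
    ((hA.target_measurable t ht).mono (hB.le_ambient t).2 le_rfl) (hA.target_law t ht)
    (hA.target_indep t ht) hE hS hp
  have hm : Measurable fun x : EuclideanSpace ℝ (Fin d) => x.ofLp := by fun_prop
  have hx : ∀ τ < t, Measurable[ℱ t] fun ω => h.history ω τ := fun τ hτ =>
    (hB.measurable_history (hA.action_mem τ (hτ.trans ht)) (hτ.trans ht)).mono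
      (filtration_le_of_lt hB.interleaved hτ) le_rfl
  exact measurable_predictionCoef hx (hm.comp (hB.feature_measurable t ht a))

theorem measurable_abs_dotProduct_apply {ι : Type*} [Fintype ι] {M : ℕ} (j : Fin M) :
    Measurable fun q : (ι → ℝ) × (Fin M → ι → ℝ) => |q.1 ⬝ᵥ q.2 j| := by
  unfold dotProduct; fun_prop

theorem measurable_sqrt_dotProduct_self {ι β : Type*} [Fintype ι] [MeasurableSpace β] :
    Measurable fun q : (ι → ℝ) × β => √(q.1 ⬝ᵥ q.1) := by
  unfold dotProduct; fun_prop

/-- With high probability, some regressor of the ensemble is optimistic at an optimal action. -/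
theorem measure_not_exists_optimistic_le [IsProbabilityMeasure μ]
    (hB : IsLinearBandit μ h ℱ 𝒢 T A B σ) (hA : IsRerandomizedACB μ h s ℱ 𝒢 T θ lam β)
    (hlam : 0 < lam) (ht : t < T) (u : ℝ) :
    μ {ω | ¬ ∃ a ∈ h.actions t ω,
        (∀ a' ∈ h.actions t ω, inner ℝ (h.feature t ω a') θ ≤ inner ℝ (h.feature t ω a) θ) ∧
        ∃ j, u * √(sqWidth lam (h.history ω) t (h.feature t ω a).ofLp)
          ≤ |inner ℝ (h.feature t ω a) (s.weight t ω j)|} ≤ ENNReal.ofReal u ^ M := by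
  obtain ⟨ω₀⟩ := nonempty_of_isProbabilityMeasure μ
  set L : Set 𝒜 := ⋃ t, ⋃ ω, (h.actions t ω : Set 𝒜) with hL
  have hmemL : ∀ ω, ∀ a ∈ h.actions t ω, a ∈ L := fun ω a ha =>
    Set.mem_iUnion.mpr ⟨t, Set.mem_iUnion.mpr ⟨ω, ha⟩⟩
  obtain ⟨a₀, ha₀⟩ := hB.actions_nonempty t ht ω₀
  obtain ⟨f, hf⟩ := hB.countable_labels.exists_eq_range ⟨a₀, hmemL ω₀ a₀ ha₀⟩
  let E : ℕ → Set Ω := fun n => {ω | f n ∈ h.actions t ω ∧ ∀ k, f k ∈ h.actions t ω →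
    inner ℝ (h.feature t ω (f k)) θ ≤ inner ℝ (h.feature t ω (f n)) θ}
  have hE : ∀ n, MeasurableSet[ℱ t] (E n) := fun n => by
    have hinner : Measurable fun x : EuclideanSpace ℝ (Fin d) => inner ℝ x θ := by fun_prop
    exact measurableSet_isOptimal (hB.actions_measurable t ht)
      (g := fun a ω => inner ℝ (h.feature t ω a) θ)
      (fun a => hinner.comp (hB.feature_measurable t ht a)) f n
  -- Disjointification selects the first optimal label in the enumeration. These events partition
  -- the space and are known before the targets, so summing over labels costs no factor A.
  have hD : ∀ n, MeasurableSet[ℱ t] (disjointed E n) := fun n =>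
    MeasurableSet.disjointed hE n
  let S : Set ((Fin d ⊕ Fin t → ℝ) × (Fin M → Fin d ⊕ Fin t → ℝ)) :=
    {q | ∀ j, |q.1 ⬝ᵥ q.2 j| < u * √(q.1 ⬝ᵥ q.1)}
  have hS : MeasurableSet S := by
    simp only [S]
    rw [Set.ofPred_forall]
    exact MeasurableSet.iInter fun j => measurableSet_lt (measurable_abs_dotProduct_apply j)
      (measurable_sqrt_dotProduct_self.const_mul u)
  have hsub : {ω | ¬ ∃ a ∈ h.actions t ω,
        (∀ a' ∈ h.actions t ω, inner ℝ (h.feature t ω a') θ ≤ inner ℝ (h.feature t ω a) θ) ∧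
        ∃ j, u * √(sqWidth lam (h.history ω) t (h.feature t ω a).ofLp)
          ≤ |inner ℝ (h.feature t ω a) (s.weight t ω j)|}
      ⊆ ⋃ n, disjointed E n ∩
        {ω | (predictionCoef lam (h.history ω) t (h.feature t ω (f n)).ofLp, s.target t ω) ∈ S} := by
    intro ω hω
    obtain ⟨a, ha, hmax⟩ := (h.actions t ω).exists_max_image
      (fun a => inner ℝ (h.feature t ω a) θ) (hB.actions_nonempty t ht ω)
    obtain ⟨n, rfl⟩ : ∃ n, f n = a := by
      have : a ∈ Set.range f := hf ▸ hmemL ω a ha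
      exact this
    have hωE : ω ∈ ⋃ n, disjointed E n := by
      rw [iUnion_disjointed]
      exact Set.mem_iUnion.mpr ⟨n, ha, fun k hk => hmax _ hk⟩
    obtain ⟨n', hn'⟩ := Set.mem_iUnion.mp hωE
    refine Set.mem_iUnion.mpr ⟨n', hn', ?_⟩
    obtain ⟨hn1, hn2⟩ := disjointed_subset E n' hn'
    intro j
    by_contra hj
    refine hω ⟨f n', hn1, fun a' ha' => ?_, j, ?_⟩
    · obtain ⟨k, rfl⟩ : ∃ k, f k = a' := by
        have : a' ∈ Set.range f := hf ▸ hmemL ω a' ha'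
        exact this
      exact hn2 k ha'
    · rw [not_lt] at hj
      rwa [predictionCoef_dotProduct_self hlam,
        ← BanditTrajectory.inner_eq_predictionCoef_dotProduct hlam
          (hA.weight_argmin t ht ω j)] at hj
  refine (measure_mono hsub).trans ((measure_iUnion_le _).trans ?_)
  calc _ ≤ ∑' n, ENNReal.ofReal u ^ M * μ (disjointed E n) :=
        ENNReal.tsum_le_tsum fun n => measure_inter_weight_le hB hA ht (f n) (hD n) hS
          fun c => pi_pi_gaussianReal_forall_lt_le M c
    _ = ENNReal.ofReal u ^ M * μ (⋃ n, disjointed E n) := by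
        rw [ENNReal.tsum_mul_left, measure_iUnion (disjoint_disjointed E)
          fun n => (hB.le_ambient t).1 _ (hD n)]
    _ ≤ ENNReal.ofReal u ^ M * 1 := by gcongr; exact prob_le_one
    _ = _ := mul_one _

/-- With high probability, no regressor of the ensemble is large at any available action. -/
theorem measure_exists_weight_large_le [IsProbabilityMeasure μ]
    (hB : IsLinearBandit μ h ℱ 𝒢 T A B σ) (hA : IsRerandomizedACB μ h s ℱ 𝒢 T θ lam β)
    (hlam : 0 < lam) (ht : t < T) {D : ℝ} (hD : 0 ≤ D) :
    μ {ω | ∃ a ∈ h.actions t ω, ∃ j,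
        D * √(sqWidth lam (h.history ω) t (h.feature t ω a).ofLp)
          < |inner ℝ (h.feature t ω a) (s.weight t ω j)|}
      ≤ M * ENNReal.ofReal (2 * Real.exp (-D ^ 2 / 2)) * A := by
  classical
  set L : Set 𝒜 := ⋃ t, ⋃ ω, (h.actions t ω : Set 𝒜) with hL
  have : Countable L := hB.countable_labels.to_subtype
  let E : 𝒜 → Set Ω := fun a => {ω | a ∈ h.actions t ω}
  have hE : ∀ a, MeasurableSet[ℱ t] (E a) := hB.actions_measurable t ht
  let S : Set ((Fin d ⊕ Fin t → ℝ) × (Fin M → Fin d ⊕ Fin t → ℝ)) :=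
    {q | ∃ j, D * √(q.1 ⬝ᵥ q.1) < |q.1 ⬝ᵥ q.2 j|}
  have hS : MeasurableSet S := by
    simp only [S]
    rw [Set.ofPred_exists]
    exact MeasurableSet.iUnion fun j => measurableSet_lt
      (measurable_sqrt_dotProduct_self.const_mul D) (measurable_abs_dotProduct_apply j)
  have hsub : {ω | ∃ a ∈ h.actions t ω, ∃ j,
        D * √(sqWidth lam (h.history ω) t (h.feature t ω a).ofLp)
          < |inner ℝ (h.feature t ω a) (s.weight t ω j)|}
      ⊆ ⋃ a : L, E a ∩
        {ω | (predictionCoef lam (h.history ω) t (h.feature t ω a).ofLp, s.target t ω) ∈ S} := by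
    rintro ω ⟨a, ha, j, hj⟩
    refine Set.mem_iUnion.mpr
      ⟨⟨a, Set.mem_iUnion.mpr ⟨t, Set.mem_iUnion.mpr ⟨ω, ha⟩⟩⟩, ha, j, ?_⟩
    rwa [predictionCoef_dotProduct_self hlam,
      ← BanditTrajectory.inner_eq_predictionCoef_dotProduct hlam (hA.weight_argmin t ht ω j)]
  refine (measure_mono hsub).trans ((measure_iUnion_le _).trans ?_)
  calc _ ≤ ∑' a : L, M * ENNReal.ofReal (2 * Real.exp (-D ^ 2 / 2)) * μ (E a) :=
        ENNReal.tsum_le_tsum fun a => measure_inter_weight_le hB hA ht a (hE a) hS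
          fun c => pi_pi_gaussianReal_exists_lt_le M c hD
    _ = M * ENNReal.ofReal (2 * Real.exp (-D ^ 2 / 2)) * ∑' a : L, μ (E a) :=
        ENNReal.tsum_mul_left
    -- The sum over all labels of the probability of being available is the expected number of
    -- available actions, at most A even when infinitely many labels occur.
    _ ≤ M * ENNReal.ofReal (2 * Real.exp (-D ^ 2 / 2)) * A := by
        gcongr
        have hEm : ∀ a, MeasurableSet (E a) := fun a => (hB.le_ambient t).1 _ (hE a)
        calc ∑' a : L, μ (E a) = ∑' a : L, ∫⁻ ω, (E a).indicator 1 ω ∂μ := by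
              simp_rw [lintegral_indicator_one (hEm _)]
          _ = ∫⁻ ω, ∑' a : L, (E a).indicator 1 ω ∂μ :=
              (lintegral_tsum (f := fun (a : L) ω => (E a).indicator 1 ω) fun a =>
                (measurable_one.indicator (hEm a)).aemeasurable).symm
          _ ≤ ∫⁻ _, (A : ℝ≥0∞) ∂μ := by
              refine lintegral_mono fun ω => ?_
              have h1 := tsum_indicator_mem_le_card L (h.actions t ω)
              have h2 : ((h.actions t ω).card : ℝ≥0∞) ≤ A := by
                exact_mod_cast hB.actions_card_le t ht ω
              refine le_trans (le_of_eq (tsum_congr fun a => ?_)) (h1.trans h2)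
              simp [Set.indicator_apply, E]
          _ = A := by simp

end Events

/-! ### From the good events to the regret -/

section Regret

open Matrix
open scoped ENNReal

variable {Ω 𝒜 : Type*} [mΩ : MeasurableSpace Ω] {μ : Measure Ω} {d M : ℕ}
  {h : BanditTrajectory Ω 𝒜 d} {s : ACBState Ω d M} {ℱ 𝒢 : ℕ → MeasurableSpace Ω}
  {T A : ℕ} {B σ : ℝ} {θ : EuclideanSpace ℝ (Fin d)} {lam β : ℝ} {t : ℕ} {ω : Ω}

/-- At an optimal action the bonus covers the estimation error, so its index is at least its true
value. The played action has a larger index, which exceeds its own true value by at most (α + βD)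
times its width. -/
theorem IsRerandomizedACB.regret_term_le (hA : IsRerandomizedACB μ h s ℱ 𝒢 T θ lam β)
    (hM : 0 < M) (ht : t < T) {α u D : ℝ} (hβ : 0 ≤ β) (hαβ : α ≤ β * u)
    (hconf : ∀ x : EuclideanSpace ℝ (Fin d), |inner ℝ x (s.thetaHat t ω) - inner ℝ x θ|
      ≤ α * √(sqWidth lam (h.history ω) t x.ofLp))
    (hopt : ∃ a ∈ h.actions t ω,
      (∀ a' ∈ h.actions t ω, inner ℝ (h.feature t ω a') θ ≤ inner ℝ (h.feature t ω a) θ) ∧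
        ∃ j, u * √(sqWidth lam (h.history ω) t (h.feature t ω a).ofLp)
          ≤ |inner ℝ (h.feature t ω a) (s.weight t ω j)|)
    (hlarge : ∀ a ∈ h.actions t ω, ∀ j, |inner ℝ (h.feature t ω a) (s.weight t ω j)|
      ≤ D * √(sqWidth lam (h.history ω) t (h.feature t ω a).ofLp)) :
    (⨆ a : {a // a ∈ h.actions t ω}, inner ℝ (h.feature t ω a) θ) - inner ℝ (h.chosen t ω) θ
      ≤ (α + β * D) * √(sqWidth lam (h.history ω) t (h.history ω t)) := by
  have : Nonempty (Fin M) := ⟨⟨0, hM⟩⟩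
  obtain ⟨a, ha, hmax, j, hj⟩ := hopt
  have : Nonempty {a // a ∈ h.actions t ω} := ⟨⟨a, ha⟩⟩
  have hsup : (⨆ a : {a // a ∈ h.actions t ω}, inner ℝ (h.feature t ω a) θ)
      ≤ inner ℝ (h.feature t ω a) θ := ciSup_le fun a' => hmax a' a'.2
  have hbonus1 : α * √(sqWidth lam (h.history ω) t (h.feature t ω a).ofLp)
      ≤ s.bonus β t ω (h.feature t ω a) := by
    calc α * √(sqWidth lam (h.history ω) t (h.feature t ω a).ofLp)
        ≤ β * u * √(sqWidth lam (h.history ω) t (h.feature t ω a).ofLp) := by gcongr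
      _ ≤ β * |inner ℝ (h.feature t ω a) (s.weight t ω j)| := by
        rw [mul_assoc]; gcongr
      _ ≤ s.bonus β t ω (h.feature t ω a) :=
        mul_le_mul_of_nonneg_left (le_ciSup (f := fun j : Fin M =>
          |inner ℝ (h.feature t ω a) (s.weight t ω j)|) (Set.finite_range _).bddAbove j) hβ
  have hmem := hA.action_mem t ht ω
  have hbonus2 : s.bonus β t ω (h.chosen t ω)
      ≤ β * (D * √(sqWidth lam (h.history ω) t (h.history ω t))) :=
    mul_le_mul_of_nonneg_left (ciSup_le fun j => hlarge _ hmem j) hβ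
  have hplay : inner ℝ (h.feature t ω a) (s.thetaHat t ω) + s.bonus β t ω (h.feature t ω a)
      ≤ inner ℝ (h.chosen t ω) (s.thetaHat t ω) + s.bonus β t ω (h.chosen t ω) :=
    isMaxOn_iff.mp (hA.action_argmax t ht ω) a ha
  have h1 := (abs_le.mp (hconf (h.feature t ω a))).1
  have h2 : _ ≤ α * √(sqWidth lam (h.history ω) t (h.history ω t)) :=
    (abs_le.mp (hconf (h.chosen t ω))).2
  linarith

theorem history_dotProduct_self_le (hB : IsLinearBandit μ h ℱ 𝒢 T A B σ)
    (hA : IsRerandomizedACB μ h s ℱ 𝒢 T θ lam β) (ht : t < T) (ω : Ω) :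
    h.history ω t ⬝ᵥ h.history ω t ≤ B ^ 2 := by
  have h1 := hB.feature_norm_le t ht ω _ (hA.action_mem t ht ω)
  have h2 : h.history ω t ⬝ᵥ h.history ω t = ‖h.chosen t ω‖ ^ 2 := by
    rw [← real_inner_self_eq_norm_sq, real_inner_eq_dotProduct]
    rfl
  rw [h2]
  exact pow_le_pow_left₀ (norm_nonneg _) h1 2

theorem sum_sqrt_sqWidth_le (hlam : 0 < lam) {x : ℕ → Fin d → ℝ} {b : ℝ} (hb : b ≤ lam)
    (hx : ∀ τ < T, x τ ⬝ᵥ x τ ≤ b) :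
    ∑ τ ∈ Finset.range T, √(sqWidth lam x τ (x τ))
      ≤ √(T * (2 * d * Real.log (1 + T * b / lam))) := by
  refine Real.le_sqrt_of_sq_le ?_
  refine sq_sum_le_card_mul_sum_sq.trans ?_
  rw [Finset.card_range]
  gcongr
  refine le_trans (le_of_eq (Finset.sum_congr rfl fun τ _ => ?_)) (sum_sqWidth_le hlam hb hx)
  exact Real.sq_sqrt (sqWidth_nonneg hlam _)

theorem measure_lt_regret_le [IsProbabilityMeasure μ] (hB : IsLinearBandit μ h ℱ 𝒢 T A B σ)
    (hA : IsRerandomizedACB μ h s ℱ 𝒢 T θ lam β) (hM : 0 < M) (hlam : 0 < lam)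
    (hBlam : B ^ 2 ≤ lam) (hσ : 0 ≤ σ) {W R p α u D : ℝ} (hθ : ‖θ‖ ≤ W) (hR : 0 < R) (hσR : σ ≤ R)
    (hp : 0 < p) (hβ : 0 ≤ β) (hD : 0 ≤ D) (hαβ : α ≤ β * u)
    (hα : R * √(2 * Real.log (1 / p) + d * Real.log (1 + T * B ^ 2 / lam)) + √lam * W ≤ α) :
    μ {ω | (α + β * D) * √(T * (2 * d * Real.log (1 + T * B ^ 2 / lam))) < h.regret θ T ω}
      ≤ T * (ENNReal.ofReal p + (ENNReal.ofReal u ^ M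
        + M * ENNReal.ofReal (2 * Real.exp (-D ^ 2 / 2)) * A)) := by
  set q := 2 * Real.log (1 / p) + d * Real.log (1 + T * B ^ 2 / lam) with hq
  let noiseSum : ℕ → Ω → Fin d → ℝ := fun t ω =>
    ∑ τ ∈ Finset.range t, (h.noise τ ω / R) • h.history ω τ
  let bad₁ : ℕ → Set Ω := fun t => {ω | q < sqWidth lam (h.history ω) t (noiseSum t ω)}
  let bad₂ : ℕ → Set Ω := fun t => {ω | ¬ ∃ a ∈ h.actions t ω,
    (∀ a' ∈ h.actions t ω, inner ℝ (h.feature t ω a') θ ≤ inner ℝ (h.feature t ω a) θ) ∧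
      ∃ j, u * √(sqWidth lam (h.history ω) t (h.feature t ω a).ofLp)
        ≤ |inner ℝ (h.feature t ω a) (s.weight t ω j)|}
  let bad₃ : ℕ → Set Ω := fun t => {ω | ∃ a ∈ h.actions t ω, ∃ j,
    D * √(sqWidth lam (h.history ω) t (h.feature t ω a).ofLp)
      < |inner ℝ (h.feature t ω a) (s.weight t ω j)|}
  have hhist : ∀ t < T, Measurable[𝒢 t] fun ω => h.history ω t := fun t ht =>
    hB.measurable_history (hA.action_mem t ht) ht
  have hbad₁ : ∀ t < T, μ (bad₁ t) ≤ ENNReal.ofReal p := by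
    intro t ht
    have hη : ∀ t < T, Measurable[ℱ (t + 1)] fun ω => h.noise t ω / R := fun t ht =>
      (hB.noise_measurable t ht).div_const R
    have hx : ∀ τ < t, Measurable fun ω => h.history ω τ := fun τ hτ =>
      (hhist τ (hτ.trans ht)).mono (hB.le_ambient τ).2 le_rfl
    have hmeas : Measurable fun ω => sqWidth lam (h.history ω) t (noiseSum t ω) := by
      refine measurable_sqWidth hx (Finset.measurable_sum _ fun τ hτ => ?_)
      have hτ' := Finset.mem_range.mp hτ
      exact ((hη τ (hτ'.trans ht)).mono (hB.le_ambient _).1 le_rfl).smul (hx τ hτ')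
    -- The threshold q is written at the horizon T and dominates the one for round t.
    refine le_trans (measure_mono ?_) (measure_lt_sqWidth_le (x := fun t ω => h.history ω t)
      (η := fun t ω => h.noise t ω / R) hB.le_ambient hB.interleaved hhist hη
      (fun t ht => (hB.noise_subgaussian t ht).div_of_le hσ hR hσR) hlam (sq_nonneg B)
      (fun t ht ω => history_dotProduct_self_le hB hA ht ω) ht.le hp hmeas)
    intro ω hω
    have hω' : q < sqWidth lam (h.history ω) t (noiseSum t ω) := hω
    refine lt_of_le_of_lt ?_ hω'
    rw [hq]
    gcongr
  have hsub : {ω | (α + β * D) * √(T * (2 * d * Real.log (1 + T * B ^ 2 / lam)))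
      < h.regret θ T ω} ⊆ ⋃ t ∈ Finset.range T, (bad₁ t ∪ (bad₂ t ∪ bad₃ t)) := by
    intro ω hω
    by_contra hgood
    simp only [Set.mem_iUnion, Finset.mem_range, not_exists, Set.mem_union, not_or] at hgood
    rw [Set.mem_ofPred_eq] at hω
    refine absurd hω (not_lt.mpr ?_)
    have hW : 0 ≤ W := (norm_nonneg θ).trans hθ
    have hα0 : 0 ≤ α := le_trans (by positivity) hα
    calc h.regret θ T ω ≤ ∑ t ∈ Finset.range T,
          (α + β * D) * √(sqWidth lam (h.history ω) t (h.history ω t)) := by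
          refine Finset.sum_le_sum fun t ht => ?_
          have ht' := Finset.mem_range.mp ht
          obtain ⟨g1, g2, g3⟩ := hgood t ht'
          refine hA.regret_term_le hM ht' hβ hαβ (fun x => ?_) (not_not.mp g2) ?_
          · refine (BanditTrajectory.abs_inner_sub_inner_le hlam (hA.thetaHat_argmin t ht' ω)
              hθ hR (not_lt.mp g1) x).trans ?_
            gcongr
          · intro a ha j
            by_contra hcon
            exact g3 ⟨a, ha, j, not_le.mp hcon⟩
      _ = (α + β * D) * ∑ t ∈ Finset.range T, √(sqWidth lam (h.history ω) t (h.history ω t)) :=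
          (Finset.mul_sum _ _ _).symm
      _ ≤ _ := by
          gcongr
          exact sum_sqrt_sqWidth_le hlam hBlam fun t ht => history_dotProduct_self_le hB hA ht ω
  refine (measure_mono hsub).trans ((measure_biUnion_finset_le _ _).trans ?_)
  calc _ ≤ ∑ _t ∈ Finset.range T, (ENNReal.ofReal p + (ENNReal.ofReal u ^ M
        + M * ENNReal.ofReal (2 * Real.exp (-D ^ 2 / 2)) * A)) := by
        refine Finset.sum_le_sum fun t ht => ?_
        have ht' := Finset.mem_range.mp ht
        refine (measure_union_le _ _).trans (add_le_add (hbad₁ t ht') ?_)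
        exact (measure_union_le _ _).trans (add_le_add
          (measure_not_exists_optimistic_le hB hA hlam ht' u)
          (measure_exists_weight_large_le hB hA hlam ht' hD))
    _ = _ := by rw [Finset.sum_const, Finset.card_range, nsmul_eq_mul]

/-- For A ≤ 1 the claimed bound is 0 because log A = 0, so this case needs the exact value. -/
theorem regret_eq_zero_of_card_le_one (hA : IsRerandomizedACB μ h s ℱ 𝒢 T θ lam β)
    (hcard : ∀ t < T, (h.actions t ω).card ≤ 1) : h.regret θ T ω = 0 := by
  refine Finset.sum_eq_zero fun t ht => ?_
  have ht' := Finset.mem_range.mp ht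
  have hmem := hA.action_mem t ht' ω
  have : Nonempty {a // a ∈ h.actions t ω} := ⟨⟨_, hmem⟩⟩
  have hconst : ∀ a : {a // a ∈ h.actions t ω},
      (inner ℝ (h.feature t ω a) θ : ℝ) = inner ℝ (h.chosen t ω) θ := fun a => by
    rw [Finset.card_le_one.mp (hcard t ht') a a.2 _ hmem]
    rfl
  simp_rw [hconst]
  rw [ciSup_const, sub_self]

end Regret

theorem regret_eq_zero_of_dim_eq_zero {Ω 𝒜 : Type*} {h : BanditTrajectory Ω 𝒜 0}
    {θ : EuclideanSpace ℝ (Fin 0)} (T : ℕ) (ω : Ω) : h.regret θ T ω = 0 := by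
  refine Finset.sum_eq_zero fun t _ => ?_
  simp [Subsingleton.elim θ 0]

/-- Subadditivity suffices, so the regret event need not be measurable. -/
theorem ofReal_one_sub_le_measure {Ω : Type*} [MeasurableSpace Ω] {μ : Measure Ω}
    [IsProbabilityMeasure μ] {δ : ℝ} {s : Set Ω} (hδ : 0 ≤ δ) (hs : μ sᶜ ≤ ENNReal.ofReal δ) :
    ENNReal.ofReal (1 - δ) ≤ μ s := by
  rw [ENNReal.ofReal_sub _ hδ, ENNReal.ofReal_one, tsub_le_iff_right]
  calc (1 : ENNReal) = μ (s ∪ sᶜ) := by rw [Set.union_compl_self, measure_univ]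
    _ ≤ μ s + μ sᶜ := measure_union_le _ _
    _ ≤ μ s + ENNReal.ofReal δ := by gcongr

/-! ### Choice of parameters and final bound -/

section Tuning

variable {d T : ℕ} {δ : ℝ}

theorem log_horizon_div_pos (hT : 1 ≤ T) (hδ0 : 0 < δ) (hδ1 : δ < 1) : 0 < Real.log (T / δ) := by
  refine Real.log_pos ((one_lt_div hδ0).mpr (hδ1.trans_le ?_))
  exact_mod_cast hT

/-- The confidence radius of the ridge estimator is of order `√d`, up to logarithmic factors. -/
theorem confidence_radius_le (hd : 1 ≤ d) (hT : 1 ≤ T) (hδ0 : 0 < δ) (hδ1 : δ < 1)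
    {R lam b W : ℝ} (hR : 0 ≤ R) (hW : 0 ≤ W) (hb : 0 ≤ b) (hlam : 0 < lam) (hblam : b ≤ lam) :
    R * √(2 * Real.log (1 / (δ / (3 * T))) + d * Real.log (1 + T * b / lam)) + √lam * W
      ≤ (3 * R + √lam * W) * √d * (1 + Real.log (T / δ))
    ∧ Real.log (1 + T * b / lam) ≤ 1 + Real.log (T / δ) := by
  have hL := log_horizon_div_pos hT hδ0 hδ1
  set L := Real.log (T / δ) with hLdef
  have hT1 : (1 : ℝ) ≤ T := by exact_mod_cast hT
  have hd1 : (1 : ℝ) ≤ d := by exact_mod_cast hd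
  have hlog3 : Real.log 3 ≤ 2 := by
    have := Real.log_le_sub_one_of_pos (show (0 : ℝ) < 3 by norm_num)
    linarith
  have h1 : Real.log (1 / (δ / (3 * T))) ≤ 2 + L := by
    have : 1 / (δ / (3 * T)) = 3 * (T / δ) := by field_simp
    rw [this, Real.log_mul (by norm_num) (by positivity)]
    linarith
  have h2 : Real.log (1 + T * b / lam) ≤ 1 + L := by
    have h3 : 1 + T * b / lam ≤ 2 * (T / δ) := by
      have h4 : T * b / lam ≤ T := by
        rw [div_le_iff₀ hlam]; gcongr
      have h5 : (T : ℝ) ≤ T / δ := le_div_self (by positivity) hδ0 hδ1.le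
      linarith
    calc Real.log (1 + T * b / lam) ≤ Real.log (2 * (T / δ)) :=
          Real.log_le_log (by positivity) h3
      _ = Real.log 2 + L := Real.log_mul (by norm_num) (by positivity)
      _ ≤ 1 + L := by
        have := Real.log_le_sub_one_of_pos (show (0 : ℝ) < 2 by norm_num)
        linarith
  refine ⟨?_, h2⟩
  have hsd : 1 ≤ √(d : ℝ) := Real.one_le_sqrt.mpr hd1
  have hq : √(2 * Real.log (1 / (δ / (3 * T))) + d * Real.log (1 + T * b / lam))
      ≤ 3 * (√d * (1 + L)) := by
    refine Real.sqrt_le_iff.mpr ⟨by positivity, ?_⟩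
    have h6 : (3 * (√d * (1 + L))) ^ 2 = 9 * (d * (1 + L) ^ 2) := by
      rw [mul_pow, mul_pow, Real.sq_sqrt (by positivity)]; norm_num
    have h7 : (d : ℝ) * Real.log (1 + T * b / lam) ≤ d * (1 + L) := by gcongr
    have h8 : (1 + L) ≤ d * (1 + L) := le_mul_of_one_le_left (by positivity) hd1
    have h9 : (d : ℝ) * (1 + L) ≤ d * (1 + L) ^ 2 := by
      gcongr
      exact le_self_pow₀ (by linarith) two_ne_zero
    rw [h6]
    linarith
  have hone : 1 ≤ √d * (1 + L) := one_le_mul_of_one_le_of_one_le hsd (by linarith)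
  calc _ ≤ R * (3 * (√d * (1 + L))) + √lam * W * (√d * (1 + L)) := by
        refine add_le_add (mul_le_mul_of_nonneg_left hq hR) ?_
        exact le_mul_of_one_le_right (by positivity) hone
    _ = _ := by ring

/-- The factor exp(-1/c) yields δ/T after M ≥ c log(T/δ) regressors; the factor 1/3 makes room for
three bad events per round. -/
theorem optimism_failure_le (hT : 1 ≤ T) (hδ0 : 0 < δ) {c : ℝ} (hc : 0 < c) {M : ℕ} (hM : 0 < M)
    (hcM : c * Real.log (T / δ) ≤ M) :
    (Real.exp (-(1 / c)) / 3) ^ M ≤ δ / (3 * T) := by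
  have hT0 : (0 : ℝ) < T := by exact_mod_cast hT
  have h1 : Real.exp (-(1 / c)) ^ M ≤ δ / T := by
    rw [← Real.exp_nat_mul]
    have h2 : δ / T = Real.exp (-Real.log (T / δ)) := by
      rw [← Real.log_inv, inv_div, Real.exp_log (by positivity)]
    rw [h2, Real.exp_le_exp]
    have h3 : Real.log (T / δ) ≤ M / c := by rwa [le_div_iff₀ hc, mul_comm]
    have h4 : M * (-(1 / c)) = -(M / c) := by ring
    linarith
  have h5 : (3 : ℝ) ≤ 3 ^ M := le_self_pow₀ (by norm_num) hM.ne'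
  rw [div_pow]
  calc Real.exp (-(1 / c)) ^ M / 3 ^ M ≤ (δ / T) / 3 := by gcongr
    _ = δ / (3 * T) := by rw [div_div, mul_comm]

/-- The width of the noise regressors over all `A` actions and `M` regressors. -/
theorem sqrt_log_union_le (hT : 1 ≤ T) (hδ0 : 0 < δ) (hδ1 : δ < 1) {C : ℝ} (hC : 0 ≤ C) {A M : ℕ}
    (hA : 2 ≤ A) (hM : 0 < M) (hMC : (M : ℝ) ≤ C * (1 + Real.log (T / δ))) :
    √(2 * Real.log (6 * A * M * (T / δ)))
      ≤ √(18 + 4 * C) * √(Real.log A) * (1 + Real.log (T / δ)) := by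
  have hL := log_horizon_div_pos hT hδ0 hδ1
  set L := Real.log (T / δ) with hLdef
  have hA2 : (2 : ℝ) ≤ A := by exact_mod_cast hA
  have hM0 : (0 : ℝ) < M := by exact_mod_cast hM
  have hT0 : (0 : ℝ) < T := by exact_mod_cast hT
  -- Since A ≥ 2, additive constants can be absorbed into multiples of log A.
  have hlogA : 1 / 2 ≤ Real.log A := by
    have := Real.log_two_gt_d9
    have := Real.log_le_log (by norm_num) hA2
    linarith
  have hlog6 : Real.log 6 ≤ 2 := by
    have h2 := Real.log_two_lt_d9
    have h3 := Real.log_three_lt_d9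
    have : Real.log 6 = Real.log 2 + Real.log 3 := by
      rw [← Real.log_mul (by norm_num) (by norm_num)]; norm_num
    linarith
  have hlogM : Real.log M ≤ C * (1 + L) := by
    have := Real.log_le_sub_one_of_pos hM0
    linarith
  refine Real.sqrt_le_iff.mpr ⟨by positivity, ?_⟩
  rw [Real.log_mul (by positivity) (by positivity), Real.log_mul (by positivity) (by positivity),
    Real.log_mul (by positivity) (by positivity), mul_pow, mul_pow, Real.sq_sqrt (by positivity),
    Real.sq_sqrt (by linarith), ← hLdef]
  have hl1 : (1 + L) ≤ 2 * (Real.log A * (1 + L)) := by nlinarith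
  have hl2 : Real.log A ≤ Real.log A * (1 + L) := le_mul_of_one_le_right (by linarith) (by linarith)
  have hl3 : Real.log A * (1 + L) ≤ Real.log A * (1 + L) ^ 2 := by
    gcongr
    exact le_self_pow₀ (by linarith) two_ne_zero
  have hl4 : C * (1 + L) ≤ C * (2 * (Real.log A * (1 + L))) := by gcongr
  have hl5 : C * (Real.log A * (1 + L)) ≤ C * (Real.log A * (1 + L) ^ 2) := by gcongr
  nlinarith

end Tuning

/-- The choice λ = 1 + B² is positive and keeps all played widths at most 1; the noise scale is R =
σ + 1; u = exp(-1/c)/3 and β = α/u. D is set so that each of the three bad events has probability at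
most δ/(3T) per round. The radius α, the factor D and the sum of widths each contribute one power of
1 + log(T/δ), whence the cube. -/
theorem measure_regret_gt_le {Ω 𝒜 : Type*} [MeasurableSpace Ω] {μ : Measure Ω}
    [IsProbabilityMeasure μ] {d M : ℕ} {h : BanditTrajectory Ω 𝒜 d} {s : ACBState Ω d M}
    {ℱ 𝒢 : ℕ → MeasurableSpace Ω} {T A : ℕ} {B σ W c C δ : ℝ} {θ : EuclideanSpace ℝ (Fin d)}
    (hσ : 0 ≤ σ) (hW : 0 ≤ W) (hc : 0 < c) (hC : 0 ≤ C) (hd : 1 ≤ d) (hT : 1 ≤ T) (hδ0 : 0 < δ)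
    (hδ1 : δ < 1) (hcM : c * Real.log (T / δ) ≤ M) (hMC : M ≤ C * (1 + Real.log (T / δ)))
    (hA2 : 2 ≤ A) (hθ : ‖θ‖ ≤ W) (hB : IsLinearBandit μ h ℱ 𝒢 T A B σ)
    (hA : IsRerandomizedACB μ h s ℱ 𝒢 T θ (1 + B ^ 2)
      ((3 * (σ + 1) + √(1 + B ^ 2) * W) * √d * (1 + Real.log (T / δ))
        / (Real.exp (-(1 / c)) / 3))) :
    μ {ω | 2 * (3 * (σ + 1) + √(1 + B ^ 2) * W)
        * (2 + √(18 + 4 * C) / (Real.exp (-(1 / c)) / 3)) * d * √(T * Real.log A)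
        * (1 + Real.log (T / δ)) ^ 3 < h.regret θ T ω} ≤ ENNReal.ofReal δ := by
  have hL := log_horizon_div_pos hT hδ0 hδ1
  set L := Real.log (T / δ) with hLdef
  have hT0 : (0 : ℝ) < T := by exact_mod_cast hT
  have hd0 : (0 : ℝ) < d := by exact_mod_cast hd
  have hM : 0 < M := by
    have : (0 : ℝ) < M := lt_of_lt_of_le (by positivity) hcM
    exact_mod_cast this
  have hM0 : (0 : ℝ) < M := by exact_mod_cast hM
  have hA0 : (2 : ℝ) ≤ A := by exact_mod_cast hA2
  have hlogA : 1 / 2 ≤ Real.log A := by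
    have := Real.log_two_gt_d9
    have := Real.log_le_log (by norm_num) hA0
    linarith
  set lam := 1 + B ^ 2 with hlamdef
  have hlam : 0 < lam := by positivity
  set u := Real.exp (-(1 / c)) / 3 with hu
  have hu0 : 0 < u := by positivity
  set K₁ := 3 * (σ + 1) + √lam * W with hK₁
  have hK₁0 : 0 < K₁ := by positivity
  set α := K₁ * √d * (1 + L) with hα
  have hα0 : 0 < α := by positivity
  set p := δ / (3 * T) with hp
  have hp0 : 0 < p := by positivity
  set D := √(2 * Real.log (6 * A * M * (T / δ))) with hD
  have hDle : D ≤ √(18 + 4 * C) * √(Real.log A) * (1 + L) :=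
    sqrt_log_union_le hT hδ0 hδ1 hC hA2 hM hMC
  have hX1 : 1 ≤ 6 * A * M * (T / δ) := by
    have h1 : 1 ≤ (T : ℝ) / δ :=
      (one_le_div hδ0).mpr (hδ1.le.trans (by exact_mod_cast hT))
    have h2 : (1 : ℝ) ≤ M := by exact_mod_cast hM
    have h3 : (1 : ℝ) ≤ 6 * A := by linarith
    exact one_le_mul_of_one_le_of_one_le (one_le_mul_of_one_le_of_one_le h3 h2) h1
  have hexp : 2 * Real.exp (-D ^ 2 / 2) = 2 * (6 * A * M * (T / δ))⁻¹ := by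
    rw [hD, neg_div, Real.sq_sqrt (mul_nonneg zero_le_two (Real.log_nonneg hX1)),
      mul_div_cancel_left₀ _ two_ne_zero, ← Real.log_inv, Real.exp_log (by positivity)]
  obtain ⟨hconf, hell⟩ := confidence_radius_le hd hT hδ0 hδ1 (R := σ + 1) (lam := lam) (b := B ^ 2)
    (by positivity) hW (sq_nonneg B) hlam (by rw [hlamdef]; linarith)
  have hmain := measure_lt_regret_le hB hA hM hlam (by rw [hlamdef]; linarith) hσ hθ
    (R := σ + 1) (p := p) (α := α) (u := u) (D := D) (by positivity) (by linarith) hp0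
    (by positivity) (Real.sqrt_nonneg _) (by rw [div_mul_cancel₀ _ hu0.ne']) hconf
  refine (measure_mono ?_).trans (hmain.trans ?_)
  · intro ω hω
    rw [Set.mem_ofPred_eq] at hω ⊢
    refine lt_of_le_of_lt ?_ hω
    have hsA : 1 ≤ 2 * √(Real.log A) := by
      have h1 : (1 / 2 : ℝ) ≤ √(Real.log A) := Real.le_sqrt_of_sq_le (by linarith)
      linarith
    have hfac : α + α / u * D ≤ α * ((2 + √(18 + 4 * C) / u) * √(Real.log A) * (1 + L)) := by
      have h1 : 1 ≤ 2 * √(Real.log A) * (1 + L) :=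
        one_le_mul_of_one_le_of_one_le hsA (by linarith)
      calc α + α / u * D
          ≤ α * (2 * √(Real.log A) * (1 + L))
            + α / u * (√(18 + 4 * C) * √(Real.log A) * (1 + L)) := by
            gcongr
            exact le_mul_of_one_le_right hα0.le h1
        _ = _ := by ring
    have hroot : √(T * (2 * d * Real.log (1 + T * B ^ 2 / lam))) ≤ 2 * (√T * √d * (1 + L)) := by
      refine Real.sqrt_le_iff.mpr ⟨by positivity, ?_⟩
      rw [mul_pow, mul_pow, mul_pow, Real.sq_sqrt hT0.le, Real.sq_sqrt hd0.le]
      have h1 : Real.log (1 + T * B ^ 2 / lam) ≤ (1 + L) ^ 2 :=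
        hell.trans (le_self_pow₀ (by linarith) two_ne_zero)
      calc T * (2 * d * Real.log (1 + T * B ^ 2 / lam)) ≤ T * (2 * d * (1 + L) ^ 2) := by gcongr
        _ ≤ 2 ^ 2 * (T * d * (1 + L) ^ 2) := by
          have : 0 ≤ T * d * (1 + L) ^ 2 := by positivity
          linarith
    have hK₂ : 0 ≤ 2 + √(18 + 4 * C) / u := by positivity
    calc (α + α / u * D) * √(T * (2 * d * Real.log (1 + T * B ^ 2 / lam)))
        ≤ α * ((2 + √(18 + 4 * C) / u) * √(Real.log A) * (1 + L)) * (2 * (√T * √d * (1 + L))) := by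
          gcongr
      _ = 2 * K₁ * (2 + √(18 + 4 * C) / u) * (√d * √d) * (√T * √(Real.log A)) * (1 + L) ^ 3 := by
          rw [hα]; ring
      _ = _ := by rw [Real.mul_self_sqrt hd0.le, ← Real.sqrt_mul hT0.le]
  · have h1 : ENNReal.ofReal u ^ M ≤ ENNReal.ofReal p := by
      rw [← ENNReal.ofReal_pow hu0.le]
      exact ENNReal.ofReal_le_ofReal (optimism_failure_le hT hδ0 hc hM hcM)
    have h2 : M * ENNReal.ofReal (2 * Real.exp (-D ^ 2 / 2)) * A = ENNReal.ofReal p := by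
      rw [hexp, ← ENNReal.ofReal_natCast M, ← ENNReal.ofReal_natCast A,
        ← ENNReal.ofReal_mul hM0.le, ← ENNReal.ofReal_mul (by positivity)]
      congr 1
      rw [hp]
      field_simp
      norm_num
    rw [h2]
    calc (T : ENNReal) * (ENNReal.ofReal p + (ENNReal.ofReal u ^ M + ENNReal.ofReal p))
        ≤ T * (ENNReal.ofReal p + (ENNReal.ofReal p + ENNReal.ofReal p)) := by gcongr
      _ = ENNReal.ofReal δ := by
        rw [← ENNReal.ofReal_natCast T, ← ENNReal.ofReal_add hp0.le hp0.le,
          ← ENNReal.ofReal_add hp0.le (by positivity), ← ENNReal.ofReal_mul hT0.le]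
        congr 1
        rw [hp]
        field_simp
        norm_num

theorem mainTheorem2 :
    ∃ k : ℕ, ∀ B W σ c C : ℝ, 0 ≤ B → 0 ≤ W → 0 ≤ σ → 0 < c → c ≤ C →
    ∃ K : ℝ, ∀ (d T : ℕ) (δ : ℝ), 1 ≤ T → 0 < δ → δ < 1 →
    ∃ lam β : ℝ, 0 < lam ∧ 0 < β ∧
      ∀ M : ℕ, c * Real.log (T / δ) ≤ M → M ≤ C * (1 + Real.log (T / δ)) →
      ∀ (A : ℕ) (Ω : Type*) (𝒜 : Type*) [MeasurableSpace Ω] (μ : Measure Ω) [IsProbabilityMeasure μ]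
        (h : BanditTrajectory Ω 𝒜 d) (s : ACBState Ω d M) (ℱ 𝒢 : ℕ → MeasurableSpace Ω)
        (θ : EuclideanSpace ℝ (Fin d)),
        ‖θ‖ ≤ W →
        IsLinearBandit μ h ℱ 𝒢 T A B σ →
        IsRerandomizedACB μ h s ℱ 𝒢 T θ lam β →
        ENNReal.ofReal (1 - δ) ≤
            μ {ω | h.regret θ T ω ≤
              K * d * Real.sqrt (T * Real.log A) * (1 + Real.log (T / δ)) ^ k} ∧
        ∀ (P : ℝ) (p : ℕ), (A : ℝ) ≤ P * (d : ℝ) ^ p →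
          ENNReal.ofReal (1 - δ) ≤
            μ {ω | h.regret θ T ω ≤
              K * d * Real.sqrt (T * (Real.log P + p * Real.log d)) *
                (1 + Real.log (T / δ)) ^ k} := by
  refine ⟨3, fun B W σ c C _ hW hσ hc hcC => ?_⟩
  set K := 2 * (3 * (σ + 1) + √(1 + B ^ 2) * W)
    * (2 + √(18 + 4 * C) / (Real.exp (-(1 / c)) / 3)) with hK
  have hK0 : 0 ≤ K := by positivity
  have hC : 0 ≤ C := hc.le.trans hcC
  refine ⟨K, fun d T δ hT hδ0 hδ1 => ?_⟩
  have hL := log_horizon_div_pos hT hδ0 hδ1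
  -- For d = 0 the general β would vanish with √d, so arbitrary positive parameters are supplied;
  -- the regret is 0.
  rcases Nat.eq_zero_or_pos d with rfl | hd
  · refine ⟨1, 1, one_pos, one_pos, fun M _ _ A Ω 𝒜 _ μ _ h s ℱ 𝒢 θ _ _ _ => ?_⟩
    have h1 : ENNReal.ofReal (1 - δ) ≤ 1 := ENNReal.ofReal_le_one.mpr (by linarith)
    constructor
    · simpa [regret_eq_zero_of_dim_eq_zero] using h1
    · intro P p _
      simpa [regret_eq_zero_of_dim_eq_zero] using h1
  refine ⟨1 + B ^ 2, (3 * (σ + 1) + √(1 + B ^ 2) * W) * √d * (1 + Real.log (T / δ))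
    / (Real.exp (-(1 / c)) / 3), by positivity, by positivity, ?_⟩
  intro M hcM hMC A Ω 𝒜 _ μ _ h s ℱ 𝒢 θ hθ hB hA
  have hfirst : ENNReal.ofReal (1 - δ) ≤ μ {ω | h.regret θ T ω ≤
      K * d * Real.sqrt (T * Real.log A) * (1 + Real.log (T / δ)) ^ 3} := by
    refine ofReal_one_sub_le_measure hδ0.le ?_
    rcases Nat.lt_or_ge A 2 with hA1 | hA2
    · have hempty : {ω | h.regret θ T ω ≤
          K * d * Real.sqrt (T * Real.log A) * (1 + Real.log (T / δ)) ^ 3}ᶜ = ∅ := by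
        rw [Set.compl_empty_iff, Set.eq_univ_iff_forall]
        intro ω
        rw [Set.mem_ofPred_eq, regret_eq_zero_of_card_le_one hA fun t ht =>
          (hB.actions_card_le t ht ω).trans (by omega)]
        positivity
      rw [hempty, measure_empty]
      exact zero_le
    · refine le_trans (measure_mono fun ω hω => ?_)
        (measure_regret_gt_le hσ hW hc hC hd hT hδ0 hδ1 hcM hMC hA2 hθ hB hA)
      rw [Set.mem_compl_iff, Set.mem_ofPred_eq, not_le] at hω
      exact hω
  refine ⟨hfirst, fun P p hP => hfirst.trans (measure_mono fun ω hω => ?_)⟩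
  rw [Set.mem_ofPred_eq] at hω ⊢
  refine hω.trans ?_
  -- Round 0 exists because T ≥ 1, so 1 ≤ A ≤ P d^p. This forces P > 0 and makes the logarithm of
  -- the product split.
  have hA1 : 1 ≤ A := (Finset.card_pos.mpr (hB.actions_nonempty 0 hT ω)).trans_le
    (hB.actions_card_le 0 hT ω)
  have hA1' : (1 : ℝ) ≤ A := by exact_mod_cast hA1
  have hd0 : (0 : ℝ) < d := by exact_mod_cast hd
  have hdp : (0 : ℝ) < (d : ℝ) ^ p := by positivity
  have hP0 : 0 < P := pos_of_mul_pos_left (lt_of_lt_of_le (by linarith) hP) hdp.le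
  have hlog : Real.log A ≤ Real.log P + p * Real.log d := by
    rw [← Real.log_pow, ← Real.log_mul hP0.ne' hdp.ne']
    exact Real.log_le_log (by linarith) hP
  gcongr
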